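/- Let $\mathscr C$ be a quasi-category (a simplicial set in which every inner horn has a filler) and let $F\colon A\to B$ be a $1$-morphism of $\mathscr C$, i.e. a $1$-simplex, regarded also as a map $F\colon\Delta[1]\to\mathscr C$. For objects $X,Y$ of $\mathscr C$ let $\mathscr C(X,Y)$ be the right-pinched space of morphisms, whose $n$-simplices are the $(n+1)$-simplices of $\mathscr C$ whose face on the vertices $0,\dots,n$ is constant at $X$ and whose last vertex is $Y$. A $1$-morphism $H$ is a composite $G\circ F$ if there is a $2$-simplex with first edge $F$, second edge $G$ and long edge $H$. The $1$-morphism $F\colon A\to B$ is an $(\infty,0)$-equivalence if there exist a $1$-morphism $G\colon B\to A$, composites $G\circ F$ and $F\circ G$, a path ($1$-simplex) from $\mathrm{id}_A$ to $G\circ F$ in $\mathscr C(A,A)$, and a path from $F\circ G$ to $\mathrm{id}_B$ in $\mathscr C(B,B)$. Let $\mathcal I$ be the walking isomorphism, the category with two objects $a,b$ and exactly one morphism between any two objects, and let $f\colon a\to b$ be its morphism. Let $N\mathcal I$ be its nerve and $\mathrm{sk}_2N\mathcal I\subseteq N\mathcal I$ its $2$-skeleton. Then the following are equivalent. 1. $F$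 is an $(\infty,0)$-equivalence in $\mathscr C$. 2. $F$ extends (strictly, as a map of simplicial sets) along $f\colon\Delta[1]\to N\mathcal I$. 3. $F$ extends along $f\colon\Delta[1]\to\mathrm{sk}_2N\mathcal I$. 4. $F$ extends along $[1,2]\colon\Delta[1]\to\Delta[0]\amalg_{\Delta[1]}\Delta[3]\amalg_{\Delta[1]}\Delta[0]$, where the target is obtained from $\Delta[3]$ by collapsing each of the edges $[0,2]$ and $[1,3]$ to a point, and the map is the image of the edge $[1,2]$ of $\Delta[3]$. -/

import Mathlib

open CategoryTheory Limits Simplicial Opposite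

universe u

namespace SSet

/-- The map `[m + 1] ⟶ [n + 1]` which extends `f : [m] ⟶ [n]` and sends the last element
to the last element. -/
def coneMap {m n : SimplexCategory} (f : m ⟶ n) : ⦋m.len + 1⦌ ⟶ ⦋n.len + 1⦌ :=
  SimplexCategory.mkHom
    { toFun := Fin.lastCases (Fin.last _) (fun i ↦ (f.toOrderHom i).castSucc)
      monotone' := by
        intro i j hij
        induction i using Fin.lastCases with
        | last =>
          obtain rfl : j = Fin.last _ := le_antisymm (Fin.le_last _) hij
          exact le_rfl
        | cast i =>
          induction j using Fin.lastCases with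
          | last => simpa using Fin.le_last _
          | cast j =>
            simpa using f.toOrderHom.monotone (by simpa using hij) }

@[simp]
lemma coneMap_last {m n : SimplexCategory} (f : m ⟶ n) :
    (coneMap f).toOrderHom (Fin.last _) = Fin.last _ :=
  Fin.lastCases_last (motive := fun _ ↦ Fin (n.len + 2))
    (last := Fin.last _) (cast := fun i ↦ (f.toOrderHom i).castSucc)

@[simp]
lemma coneMap_castSucc {m n : SimplexCategory} (f : m ⟶ n) (i : Fin (m.len + 1)) :
    (coneMap f).toOrderHom i.castSucc = (f.toOrderHom i).castSucc :=
  Fin.lastCases_castSucc (motive := fun _ ↦ Fin (n.len + 2))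
    (last := Fin.last _) (cast := fun i ↦ (f.toOrderHom i).castSucc) i

lemma coneMap_id (m : SimplexCategory) : coneMap (𝟙 m) = 𝟙 _ := by
  ext i : 3
  induction i using Fin.lastCases with
  | last => rw [coneMap_last]; rfl
  | cast i => rw [coneMap_castSucc]; rfl

lemma coneMap_comp {m n p : SimplexCategory} (f : m ⟶ n) (g : n ⟶ p) :
    coneMap (f ≫ g) = coneMap f ≫ coneMap g := by
  ext i : 3
  induction i using Fin.lastCases with
  | last =>
    rw [coneMap_last, SimplexCategory.comp_toOrderHom, OrderHom.comp_coe, Function.comp_apply,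
      coneMap_last, coneMap_last]
  | cast i =>
    rw [coneMap_castSucc, SimplexCategory.comp_toOrderHom, SimplexCategory.comp_toOrderHom]
    simp

lemma δ_last_coneMap {m n : SimplexCategory} (f : m ⟶ n) :
    (SimplexCategory.δ (Fin.last (m.len + 1)) : ⦋m.len⦌ ⟶ ⦋m.len + 1⦌) ≫ coneMap f =
      SimplexCategory.Hom.mk f.toOrderHom ≫
        (SimplexCategory.δ (Fin.last (n.len + 1)) : ⦋n.len⦌ ⟶ ⦋n.len + 1⦌) := by
  ext i : 3
  have h (k : ℕ) (j : Fin (k + 1)) :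
      (SimplexCategory.δ (Fin.last (k + 1)) : ⦋k⦌ ⟶ ⦋k + 1⦌).toOrderHom j = j.castSucc :=
    Fin.succAbove_last_apply j
  rw [SimplexCategory.comp_toOrderHom, SimplexCategory.comp_toOrderHom]
  simp only [OrderHom.comp_coe, Function.comp_apply]
  rw [h]
  erw [h]
  rw [coneMap_castSucc]
  rfl

lemma const_last_coneMap {m n : SimplexCategory} (f : m ⟶ n) :
    SimplexCategory.const ⦋0⦌ ⦋m.len + 1⦌ (Fin.last _) ≫ coneMap f =
      SimplexCategory.const ⦋0⦌ ⦋n.len + 1⦌ (Fin.last _) := by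
  rw [SimplexCategory.const_comp, coneMap_last]

/-- The space of morphisms from `x` to `y` (the right-pinched hom space): its `n`-simplices
are the `(n + 1)`-simplices of `C` whose face spanned by the vertices `0, …, n` is constant
at `x` and whose last vertex is `y`. -/
def homR (C : SSet.{u}) (x y : C _⦋0⦌) : SSet.{u} where
  obj m := { z : C _⦋m.unop.len + 1⦌ //
    C.map (SimplexCategory.δ (Fin.last (m.unop.len + 1))).op z =
      C.map (SimplexCategory.const ⦋m.unop.len⦌ ⦋0⦌ 0).op x ∧
    C.map (SimplexCategory.const ⦋0⦌ ⦋m.unop.len + 1⦌ (Fin.last _)).op z = y }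
  map {m n} f := ↾fun z ↦ ⟨C.map (coneMap f.unop).op z.1, by
    constructor
    · rw [← Functor.map_comp_apply, ← op_comp, δ_last_coneMap, op_comp,
        Functor.map_comp_apply, z.2.1, ← Functor.map_comp_apply, ← op_comp]
      rfl
    · rw [← Functor.map_comp_apply, ← op_comp, const_last_coneMap]
      exact z.2.2⟩
  map_id m := by
    ext z
    change C.map (coneMap (𝟙 m.unop)).op z.1 = z.1
    simp [coneMap_id]
  map_comp f g := by
    ext z
    change C.map (coneMap (g.unop ≫ f.unop)).op z.1 =
      C.map (coneMap g.unop).op (C.map (coneMap f.unop).op z.1)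
    simp [coneMap_comp]

/-- A morphism from `x` to `y`, as a point of the space of morphisms. -/
def Edge.toHomR {C : SSet.{u}} {x y : C _⦋0⦌} (e : Edge x y) : (homR C x y) _⦋0⦌ :=
  ⟨e.edge, by
    constructor
    · exact e.src_eq.trans (by simp)
    · have h : SimplexCategory.const ⦋0⦌ ⦋1⦌ (Fin.last 1) = SimplexCategory.δ 0 :=
        SimplexCategory.δ_zero_eq_const.symm
      exact (congrArg (fun k ↦ C.map (Quiver.Hom.op k) e.edge) h).trans e.tgt_eq⟩


/-- Two points of a space `X` are `(∞,-1)`-equivalent if there is a path between them. -/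
def JoinedByPath {X : SSet.{u}} (p q : X _⦋0⦌) : Prop :=
  Nonempty (Edge p q)

/-- `h` is a composite `g ∘ f` of `f : x ⟶ y` and `g : y ⟶ z`, i.e. there is a `2`-simplex with
boundary `f`, `g`, `h`. In a quasi-category composites exist and are unique up to
a contractible choice. -/
def IsComposite {C : SSet.{u}} {x y z : C _⦋0⦌} (f : Edge x y) (g : Edge y z) (h : Edge x z) :
    Prop :=
  Nonempty (Edge.CompStruct f g h)

/-- A morphism `F : A ⟶ B` of a quasi-category is an `(∞,0)`-equivalence if there are
`G : B ⟶ A` and paths from `id_A` to `G ∘ F` in the space of morphisms from `A` to `A`,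
and from `F ∘ G` to `id_B` in the space of morphisms from `B` to `B`. -/
def IsInftyZeroEquivalence {C : SSet.{u}} {A B : C _⦋0⦌} (F : Edge A B) : Prop :=
  ∃ (G : Edge B A) (GF : Edge A A) (FG : Edge B B),
    IsComposite F G GF ∧ IsComposite G F FG ∧
    JoinedByPath (Edge.id A).toHomR GF.toHomR ∧
    JoinedByPath FG.toHomR (Edge.id B).toHomR

/-- The map `Δ[1] ⟶ C` corresponding to a morphism of `C`. -/
def Edge.toMap {C : SSet.{u}} {x y : C _⦋0⦌} (e : Edge x y) : Δ[1] ⟶ C :=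
  yonedaEquiv.symm e.edge

/-- The inclusion of `Δ[1]` in the nerve of the walking isomorphism. -/
def walkingIsoInclusion : Δ[1] ⟶ coherentIso.{u} :=
  coherentIso.hom.toMap

/-- The `2`-skeleton of the nerve of the walking isomorphism, generated by the simplices of
dimension `< 3`. -/
abbrev skTwoCoherentIso : coherentIso.{u}.Subcomplex :=
  coherentIso.skeleton 3

/-- The inclusion of `Δ[1]` in the `2`-skeleton of the nerve of the walking isomorphism. -/
def skTwoInclusion : Δ[1] ⟶ (skTwoCoherentIso.{u} : SSet.{u}) :=
  yonedaEquiv.symm ⟨coherentIso.hom.edge, mem_skeleton _ _⟩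

/-- The edge `[i, j]` of `Δ[3]`. -/
def edgeThree (i j : Fin 4) (h : i ≤ j) : Δ[1] ⟶ (Δ[3] : SSet.{u}) :=
  SSet.stdSimplex.map (SimplexCategory.mkOfLe i j h)

/-- The map from `Δ[1]` to the point. -/
def collapse : Δ[1] ⟶ (Δ[0] : SSet.{u}) :=
  SSet.stdSimplex.map (SimplexCategory.const ⦋1⦌ ⦋0⦌ 0)

/-- The pushout of `Δ[0] ⟵ Δ[1] ⟶ Δ[3]`, collapsing the edge `[0, 2]`. -/
noncomputable abbrev collapseOne : SSet.{u} :=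
  pushout (edgeThree 0 2 (by decide)) collapse

/-- The quotient map from `Δ[3]`. -/
noncomputable abbrev toCollapseOne : Δ[3] ⟶ collapseOne.{u} :=
  pushout.inl _ _

/-- The iterated pushout `Δ[0] ⊔_{Δ[1]} Δ[3] ⊔_{Δ[1]} Δ[0]`, which collapses each of the edges
`[0, 2]` and `[1, 3]` of `Δ[3]` to a point. -/
noncomputable abbrev collapseTwo : SSet.{u} :=
  pushout (edgeThree 1 3 (by decide) ≫ toCollapseOne) collapse

/-- The quotient map from `Δ[3]`. -/
noncomputable abbrev toCollapseTwo : Δ[3] ⟶ collapseTwo.{u} :=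
  toCollapseOne ≫ pushout.inl _ _

/-- The edge `[1, 2]` of `Δ[0] ⊔_{Δ[1]} Δ[3] ⊔_{Δ[1]} Δ[0]`. -/
noncomputable def collapseTwoInclusion : Δ[1] ⟶ collapseTwo.{u} :=
  edgeThree 1 2 (by decide) ≫ toCollapseTwo

end SSet

namespace SSet

/-! Everything is compared with invertibility of `F` (`F.InvStruct`): an edge `G` and two triangles
with boundaries `F, G, id` and `G, F, id`. A path in a right-pinched morphism space is a homotopy
triangle, so an `(∞,0)`-equivalence is the same as an invertible edge. An extension to the
2-skeleton or to the collapsed `Δ[3]` supplies an inverse on each side; these agree in the homotopy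
category.

The substance is that an invertible edge extends over the whole nerve of the walking isomorphism.
`Edge.InvStruct.exists_threeSimplex` corrects the two triangles to a 3-simplex `w` with vertices `A,
B, A, B` and faces `δ 1 w`, `δ 2 w` degenerate on `F`. With `w`, horns `Λ[m + 2, 0]` with initial
edge `F` can be filled (`exists_filler_of_initialEdge`): the horn is spread over part of `Δ[m + 4]`,
with `w` on the vertices `0, 1, 2, 3`, and the extension then uses only inner horns.

Filling such horns repeatedly yields simplices of every dimension with vertices `A, B, A, B, …`,
each the last face of the next, whose pullbacks depend only on parities of vertices
(`IsAlternating`). A simplex of the nerve is a word in two letters, that is, a sequence of parities,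
so these simplices assemble into the extension (`exists_coherentIso_hom`). The other two extensions
follow by composing with maps into the nerve. -/

/-- A natural, total and single-valued relation between the simplices of `X` and those of `C`
is the graph of a morphism. -/
lemma exists_hom_of_rel {X C : SSet.{u}} (R : ∀ d : ℕ, X _⦋d⦌ → C _⦋d⦌ → Prop)
    (total : ∀ d x, ∃ c, R d x c)
    (unique : ∀ d x c c', R d x c → R d x c' → c = c')
    (natural : ∀ (d e : ℕ) (f : ⦋e⦌ ⟶ ⦋d⦌) (x c), R d x c →
      R e (X.map f.op x) (C.map f.op c)) :
    ∃ ψ : X ⟶ C, ∀ d x c, R d x c → ψ.app (op ⦋d⦌) x = c := by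
  choose g hg using total
  refine ⟨{ app k := ↾fun x ↦ g k.unop.len x
            naturality k l f := ?_ }, fun d x c h ↦ unique d x _ _ (hg d x) h⟩
  ext x
  exact unique _ _ _ _ (hg _ _) (natural k.unop.len l.unop.len f.unop x _ (hg _ x))

/-! ### Subcomplexes of a simplex given by lower sets of faces, and inner horn extensions between
them -/

namespace stdSimplex

lemma map_app_apply {n m d : ℕ} (f : ⦋n⦌ ⟶ ⦋m⦌) (x : (Δ[n] : SSet.{u}) _⦋d⦌) (i : Fin (d + 1)) :
    ((SSet.stdSimplex.map f).app (op ⦋d⦌) x : (Δ[m] : SSet.{u}) _⦋d⦌) i = f.toOrderHom (x i) := rfl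

/-- The subcomplex of `Δ[n]` consisting of the simplices whose set of vertices belongs to
a given lower set. -/
def ofLowerSet {n : ℕ} (P : LowerSet (Finset (Fin (n + 1)))) : (Δ[n] : SSet.{u}).Subcomplex where
  obj k := {x | Finset.univ.image (objEquiv x).toOrderHom ∈ P}
  map {k l} f x hx := P.lower (by
    intro a ha
    simp only [Finset.mem_image, Finset.mem_univ, true_and] at ha ⊢
    obtain ⟨b, rfl⟩ := ha
    exact ⟨f.unop.toOrderHom b, rfl⟩) hx

lemma mem_ofLowerSet_iff {n d : ℕ} (P : LowerSet (Finset (Fin (n + 1))))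
    (x : (Δ[n] : SSet.{u}) _⦋d⦌) :
    x ∈ (ofLowerSet.{u} P).obj (op ⦋d⦌) ↔ Finset.univ.image x ∈ P := Iff.rfl

lemma ofLowerSet_mono {n : ℕ} {P Q : LowerSet (Finset (Fin (n + 1)))} (h : P ≤ Q) :
    ofLowerSet.{u} P ≤ ofLowerSet Q := fun _ _ hx ↦ h hx

end stdSimplex

open _root_.SSet.stdSimplex

/-- Attaching the face with vertices `T` along the horn opposite to `U = T \ {v}`. -/
lemma exists_extension_sup_Iic {C : SSet.{u}} [Quasicategory C] {N : ℕ}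
    (P : LowerSet (Finset (Fin (N + 1)))) (v : Fin (N + 1)) (U : Finset (Fin (N + 1)))
    (hv : v ∉ U) (hU : U ∉ P) (hP : ∀ a ∈ U, (insert v U).erase a ∈ P)
    (h₁ : ∃ a ∈ U, a < v) (h₂ : ∃ b ∈ U, v < b)
    (φ : (ofLowerSet P : SSet.{u}) ⟶ C) :
    ∃ ψ : (ofLowerSet (P ⊔ LowerSet.Iic (insert v U)) : SSet.{u}) ⟶ C,
      Subcomplex.homOfLE (ofLowerSet_mono le_sup_left) ≫ ψ = φ := by
  obtain ⟨n, hn⟩ : ∃ n, (insert v U).card = n + 1 :=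
    ⟨U.card, Finset.card_insert_of_notMem hv⟩
  let e := (insert v U).orderEmbOfFin hn
  have he : ∀ a, a ∈ insert v U → ∃ i, e i = a := fun a ha ↦ by
    have : a ∈ Set.range e := by rw [Finset.range_orderEmbOfFin]; exact ha
    exact this
  have he' : ∀ i, e i ∈ insert v U := fun i ↦ Finset.orderEmbOfFin_mem _ hn i
  obtain ⟨i, hi⟩ := he v (by simp)
  have hi₀ : 0 < i := by
    obtain ⟨a, ha, hav⟩ := h₁
    obtain ⟨j, rfl⟩ := he a (by simp [ha])
    rw [← hi, e.lt_iff_lt] at hav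
    exact lt_of_le_of_lt (Fin.zero_le j) hav
  have hi₁ : i < Fin.last n := by
    obtain ⟨a, ha, hav⟩ := h₂
    obtain ⟨j, rfl⟩ := he a (by simp [ha])
    rw [← hi, e.lt_iff_lt] at hav
    exact lt_of_lt_of_le hav (Fin.le_last j)
  let σ : (Δ[n] : SSet.{u}) ⟶ Δ[N] :=
    SSet.stdSimplex.map (SimplexCategory.mkHom e.toOrderHom)
  have hσ {d : ℕ} (x : (Δ[n] : SSet.{u}) _⦋d⦌) (j) :
      (σ.app (op ⦋d⦌) x : (Δ[N] : SSet.{u}) _⦋d⦌) j = e (x j) := rfl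
  have hσinj {d : ℕ} (x y : (Δ[n] : SSet.{u}) _⦋d⦌)
      (h : σ.app (op ⦋d⦌) x = σ.app (op ⦋d⦌) y) : x = y := by
    apply stdSimplex.ext
    intro j
    have := congrArg (fun z : (Δ[N] : SSet.{u}) _⦋d⦌ ↦ z j) h
    exact e.injective this
  -- The new face meets `P` exactly in the horn: a simplex missing some vertex of `U` lies in a
  -- facet covered by `hP`, while one hitting all of `U` would put `U` in `P`.
  have hhorn {d : ℕ} (x : (Δ[n] : SSet.{u}) _⦋d⦌) :
      x ∈ (Λ[n, i] : (Δ[n] : SSet.{u}).Subcomplex).obj (op ⦋d⦌) ↔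
        σ.app (op ⦋d⦌) x ∈ (ofLowerSet P).obj (op ⦋d⦌) := by
    rw [mem_horn_iff_notMem_range, mem_ofLowerSet_iff]
    constructor
    · rintro ⟨j, hj, hx⟩
      have hjU : e j ∈ U := by
        refine (Finset.mem_insert.1 (he' j)).resolve_left fun h ↦ hj (e.injective (h.trans hi.symm))
      refine P.lower ?_ (hP _ hjU)
      intro a ha
      simp only [Finset.mem_image, Finset.mem_univ, true_and] at ha
      obtain ⟨b, rfl⟩ := ha
      rw [hσ, Finset.mem_erase]
      exact ⟨fun h ↦ hx ⟨b, e.injective h⟩, he' _⟩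
    · intro h
      by_contra! H
      refine hU (P.lower ?_ h)
      intro a ha
      obtain ⟨j, rfl⟩ := he a (by simp [ha])
      obtain ⟨b, rfl⟩ := H j (by rintro rfl; rw [hi] at ha; exact hv ha)
      simp only [Finset.mem_image, Finset.mem_univ, true_and]
      exact ⟨b, rfl⟩
  have hle : Subcomplex.range ((Λ[n, i] : (Δ[n] : SSet.{u}).Subcomplex).ι ≫ σ) ≤
      ofLowerSet P := by
    rintro ⟨k⟩ _ ⟨⟨x, hx⟩, rfl⟩
    induction k using SimplexCategory.rec with | _ d
    exact (hhorn x).1 hx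
  obtain ⟨h, hh⟩ := Quasicategory.hornFilling hi₀ hi₁ (Subcomplex.lift _ hle ≫ φ)
  have hh' {d : ℕ} (x : (Δ[n] : SSet.{u}) _⦋d⦌)
      (hx : σ.app (op ⦋d⦌) x ∈ (ofLowerSet P).obj (op ⦋d⦌)) :
      φ.app (op ⦋d⦌) ⟨_, hx⟩ = h.app (op ⦋d⦌) x :=
    ConcreteCategory.congr_hom (congrArg (fun f ↦ NatTrans.app f (op ⦋d⦌)) hh) ⟨x, (hhorn x).2 hx⟩
  -- Gluing `φ` on `P` with the filler `h` on the new face; `hh'` is their agreement on the overlap.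
  obtain ⟨ψ, hψ⟩ := exists_hom_of_rel
    (X := (ofLowerSet (P ⊔ LowerSet.Iic (insert v U)) : SSet.{u})) (C := C)
    (fun d y c ↦ (∃ hy : y.1 ∈ (ofLowerSet P).obj (op ⦋d⦌), φ.app (op ⦋d⦌) ⟨y.1, hy⟩ = c) ∨
      ∃ x : (Δ[n] : SSet.{u}) _⦋d⦌, σ.app (op ⦋d⦌) x = y.1 ∧ h.app (op ⦋d⦌) x = c) (by
      rintro d ⟨y, hy⟩
      by_cases hyP : y ∈ (ofLowerSet P).obj (op ⦋d⦌)
      · exact ⟨_, Or.inl ⟨hyP, rfl⟩⟩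
      · have hyT : Finset.univ.image y ≤ insert v U :=
          (Or.resolve_left (show _ ∨ _ from hy) hyP)
        have hyT' (j) : y j ∈ insert v U := hyT (by simp)
        choose x hx using fun j ↦ he (y j) (hyT' j)
        refine ⟨_, Or.inr ⟨objMk ⟨x, fun a b hab ↦ ?_⟩, ?_, rfl⟩⟩
        · rw [← e.le_iff_le, hx, hx]
          exact monotone_apply y hab
        · apply stdSimplex.ext
          intro j
          exact hx j) (by
      rintro d y c c' (⟨hy, rfl⟩ | ⟨x, hx, rfl⟩) (⟨hy', rfl⟩ | ⟨x', hx', rfl⟩)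
      · rfl
      · obtain ⟨y, _⟩ := y
        dsimp only at hx' hy
        subst hx'
        exact hh' _ _
      · obtain ⟨y, _⟩ := y
        dsimp only at hx hy'
        subst hx
        exact (hh' _ _).symm
      · rw [hσinj x x' (hx.trans hx'.symm)]) (by
      rintro d e f y c (⟨hy, rfl⟩ | ⟨x, hx, rfl⟩)
      · exact Or.inl ⟨(ofLowerSet P).map f.op hy, NatTrans.naturality_apply φ f.op ⟨y.1, hy⟩⟩
      · refine Or.inr ⟨(Δ[n] : SSet.{u}).map f.op x, ?_, NatTrans.naturality_apply h f.op x⟩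
        rw [NatTrans.naturality_apply σ f.op x, hx]
        rfl)
  refine ⟨ψ, ?_⟩
  ext k y
  obtain ⟨k⟩ := k
  induction k using SimplexCategory.rec with | _ d
  exact hψ d _ _ (Or.inl ⟨y.2, rfl⟩)

/-- If the simplices of `Q` which are not in `P` are paired by adding or removing an inner
vertex `v`, then morphisms to a quasi-category extend from `P` to `Q`. -/
lemma exists_extension_of_pivot {C : SSet.{u}} [Quasicategory C] {N : ℕ}
    (P Q : LowerSet (Finset (Fin (N + 1)))) (v : Fin (N + 1)) (hPQ : P ≤ Q)
    (hins : ∀ U ∈ Q, U ∉ P → insert v U ∈ Q) (her : ∀ U ∈ Q, U ∉ P → U.erase v ∉ P)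
    (h₁ : ∀ U ∈ Q, U ∉ P → ∃ a ∈ U, a < v) (h₂ : ∀ U ∈ Q, U ∉ P → ∃ b ∈ U, v < b)
    (φ : (ofLowerSet P : SSet.{u}) ⟶ C) :
    ∃ ψ : (ofLowerSet Q : SSet.{u}) ⟶ C, Subcomplex.homOfLE (ofLowerSet_mono hPQ) ≫ ψ = φ := by
  classical
  obtain ⟨n, hn⟩ : ∃ n, (Finset.univ.filter fun U ↦ U ∈ Q ∧ U ∉ P).card = n := ⟨_, rfl⟩
  induction n using Nat.strong_induction_on generalizing P with
  | _ n ih =>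
    by_cases hQP : Q ≤ P
    · obtain rfl := le_antisymm hPQ hQP
      exact ⟨φ, rfl⟩
    obtain ⟨U₀, hU₀, hU₀'⟩ := Set.not_subset.1 hQP
    -- A missing face of least cardinality omits `v`. Attaching `insert v U` adds it together with
    -- `U`: any other missing facet would, after erasing `v`, give a missing face smaller than `U`.
    obtain ⟨U, hU, hmin⟩ := Finset.exists_min_image
      (Finset.univ.filter fun U ↦ U ∈ Q ∧ U ∉ P) Finset.card ⟨U₀, by simpa using ⟨hU₀, hU₀'⟩⟩
    simp only [Finset.mem_filter, Finset.mem_univ, true_and, and_imp] at hU hmin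
    obtain ⟨hUQ, hUP⟩ := hU
    have hv : v ∉ U := fun h ↦ by
      have := hmin _ (Q.lower (Finset.erase_subset v U) hUQ) (her U hUQ hUP)
      have := Finset.card_erase_lt_of_mem h
      omega
    have hT := hins U hUQ hUP
    obtain ⟨φ', hφ'⟩ := exists_extension_sup_Iic P v U hv hUP (by
      intro a ha
      by_contra H
      have hQ : (insert v U).erase a ∈ Q := Q.lower (Finset.erase_subset _ _) hT
      have h3 := hmin _ (Q.lower (Finset.erase_subset v _) hQ) (her _ hQ H)
      have h4 : ((insert v U).erase a).erase v = U.erase a := by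
        rw [Finset.erase_right_comm, Finset.erase_insert hv]
      rw [h4] at h3
      have := Finset.card_erase_lt_of_mem ha
      omega) (h₁ U hUQ hUP) (h₂ U hUQ hUP) φ
    have hP' : ∀ V, V ∉ P ⊔ LowerSet.Iic (insert v U) ↔ V ∉ P ∧ ¬ V ⊆ insert v U := fun V ↦ by
      rw [LowerSet.mem_sup_iff, not_or]; rfl
    obtain ⟨ψ, hψ⟩ := ih _ (by
      rw [← hn]
      refine Finset.card_lt_card (Finset.ssubset_iff_of_subset ?_ |>.2 ⟨U, ?_, ?_⟩)
      · intro V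
        simp only [Finset.mem_filter, Finset.mem_univ, true_and, hP']
        tauto
      · simpa using ⟨hUQ, hUP⟩
      · simp) (P ⊔ LowerSet.Iic (insert v U))
      (sup_le hPQ (LowerSet.Iic_le.2 hT))
      (fun V hV hV' ↦ hins V hV ((hP' V).1 hV').1)
      (fun V hV hV' ↦ by
        rw [hP'] at hV' ⊢
        refine ⟨her V hV hV'.1, fun h ↦ hV'.2 ?_⟩
        intro a ha
        by_cases hav : a = v
        · simp [hav]
        · exact h (Finset.mem_erase.2 ⟨hav, ha⟩))
      (fun V hV hV' ↦ h₁ V hV ((hP' V).1 hV').1)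
      (fun V hV hV' ↦ h₂ V hV ((hP' V).1 hV').1) φ' rfl
    exact ⟨ψ, by rw [← hφ', ← hψ]; rfl⟩

/-! ### Filling outer horns whose initial edge is invertible -/

namespace SpecialOuterHorn

variable (m : ℕ)

/-- The simplices of `Δ[m + 4]` on which the extension problem is initially defined. -/
def P₀ : LowerSet (Finset (Fin (m + 5))) where
  -- The first clause is where `w` is used. On the other two the horn is pulled back along `fold`,
  -- which is monotone on faces not containing both `1` and `2`; the image misses `j - 2 ≥ 2` in the
  -- second clause and `1` in the third, so it lies in the horn.
  carrier := {U | (∀ x ∈ U, x.val < 4) ∨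
    ((∀ x ∈ U, ∀ y ∈ U, ¬ (x.val = 1 ∧ y.val = 2)) ∧ ∃ j : Fin (m + 5), 4 ≤ j.val ∧ j ∉ U) ∨
    ∀ x ∈ U, x.val ≠ 1 ∧ x.val ≠ 3}
  lower' U V hVU := by
    rintro (h | ⟨h, j, hj, hj'⟩ | h)
    · exact Or.inl fun x hx ↦ h x (hVU hx)
    · exact Or.inr (Or.inl ⟨fun x hx y hy ↦ h x (hVU hx) y (hVU hy), j, hj, fun h ↦ hj' (hVU h)⟩)
    · exact Or.inr (Or.inr fun x hx ↦ h x (hVU hx))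

/-- The join of `Δ[3]` and the boundary of `Δ[m]`, together with the join of the edge `[0, 2]`
and `Δ[m]`. -/
def P₁ : LowerSet (Finset (Fin (m + 5))) where
  carrier := {U | (∀ x ∈ U, x.val < 4) ∨ (∃ j : Fin (m + 5), 4 ≤ j.val ∧ j ∉ U) ∨
    ∀ x ∈ U, x.val ≠ 1 ∧ x.val ≠ 3}
  lower' U V hVU := by
    rintro (h | ⟨j, hj, hj'⟩ | h)
    · exact Or.inl fun x hx ↦ h x (hVU hx)
    · exact Or.inr (Or.inl ⟨j, hj, fun h ↦ hj' (hVU h)⟩)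
    · exact Or.inr (Or.inr fun x hx ↦ h x (hVU hx))

/-- The union of `P₁` and the face opposite to the vertex `3`. -/
def P₂ : LowerSet (Finset (Fin (m + 5))) where
  carrier := {U | U ∈ P₁ m ∨ ∀ x ∈ U, x.val ≠ 3}
  lower' U V hVU := by
    rintro (h | h)
    · exact Or.inl ((P₁ m).lower hVU h)
    · exact Or.inr fun x hx ↦ h x (hVU hx)

variable {m}

lemma mem_P₀_iff {U : Finset (Fin (m + 5))} : U ∈ P₀ m ↔ (∀ x ∈ U, x.val < 4) ∨
    ((∀ x ∈ U, ∀ y ∈ U, ¬ (x.val = 1 ∧ y.val = 2)) ∧ ∃ j : Fin (m + 5), 4 ≤ j.val ∧ j ∉ U) ∨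
    ∀ x ∈ U, x.val ≠ 1 ∧ x.val ≠ 3 := Iff.rfl

lemma mem_P₁_iff {U : Finset (Fin (m + 5))} : U ∈ P₁ m ↔
    (∀ x ∈ U, x.val < 4) ∨ (∃ j : Fin (m + 5), 4 ≤ j.val ∧ j ∉ U) ∨
    ∀ x ∈ U, x.val ≠ 1 ∧ x.val ≠ 3 := Iff.rfl

lemma mem_P₂_iff {U : Finset (Fin (m + 5))} :
    U ∈ P₂ m ↔ U ∈ P₁ m ∨ ∀ x ∈ U, x.val ≠ 3 := Iff.rfl

lemma P₀_le_P₁ : P₀ m ≤ P₁ m := by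
  rintro U (h | ⟨_, h⟩ | h)
  exacts [Or.inl h, Or.inr (Or.inl h), Or.inr (Or.inr h)]

lemma P₁_le_P₂ : P₁ m ≤ P₂ m := fun _ ↦ Or.inl

/-- The vertex `a` of `Δ[m + 4]`, for `a ≤ 4`. -/
abbrev vtx (m a : ℕ) (ha : a < 5 := by decide) : Fin (m + 5) := ⟨a, by omega⟩

/-- Vertex `3` is unconstrained here and lies strictly between `2` and a vertex `≥ 4`, so it can
serve as inner pivot from `P₀` to `P₁`. -/
lemma mem_P₁_not_P₀ {U : Finset (Fin (m + 5))} (h₁ : U ∈ P₁ m) (h₀ : U ∉ P₀ m) :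
    vtx m 1 ∈ U ∧ vtx m 2 ∈ U ∧ (∃ x ∈ U, 4 ≤ x.val) ∧ ∃ j : Fin (m + 5), 4 ≤ j.val ∧ j ∉ U := by
  rw [mem_P₁_iff] at h₁
  rw [mem_P₀_iff] at h₀
  push Not at h₀
  obtain ⟨⟨x, hx, hx'⟩, h₂, h₃⟩ := h₀
  have hj := (h₁.resolve_left (fun h ↦ by have := h x hx; omega)).resolve_right (fun h ↦ by
    obtain ⟨y, hy, hy'⟩ := h₃
    exact (h y hy).2 (hy' (h y hy).1))
  by_cases H : ∀ x ∈ U, ∀ y ∈ U, x.val = 1 → y.val ≠ 2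
  · obtain ⟨j, hj, hj'⟩ := hj
    exact absurd (h₂ H j hj) hj'
  · push Not at H
    obtain ⟨a, ha, b, hb, ha', hb'⟩ := H
    obtain rfl : a = vtx m 1 := Fin.ext ha'
    obtain rfl : b = vtx m 2 := Fin.ext hb'
    exact ⟨ha, hb, ⟨x, hx, hx'⟩, hj⟩

/-- Now vertex `2` is unconstrained and lies between `1` and `4`: it is the pivot from `P₁` to `P₂`.
-/
lemma mem_P₂_not_P₁ {U : Finset (Fin (m + 5))} (h₂ : U ∈ P₂ m) (h₁ : U ∉ P₁ m) :
    vtx m 1 ∈ U ∧ (∀ x ∈ U, x.val ≠ 3) ∧ ∀ j : Fin (m + 5), 4 ≤ j.val → j ∈ U := by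
  have h₃ := (mem_P₂_iff.1 h₂).resolve_left h₁
  rw [mem_P₁_iff] at h₁
  push Not at h₁
  obtain ⟨_, h₄, a, ha, ha'⟩ := h₁
  obtain rfl : a = vtx m 1 := Fin.ext (by by_contra H; exact h₃ a ha (ha' H))
  exact ⟨ha, h₃, h₄⟩

variable {C : SSet.{u}} [Quasicategory C]

lemma exists_extension (φ : (ofLowerSet (P₀ m) : SSet.{u}) ⟶ C) :
    ∃ ψ : (ofLowerSet (P₂ m) : SSet.{u}) ⟶ C,
      Subcomplex.homOfLE (ofLowerSet_mono (P₀_le_P₁.trans P₁_le_P₂)) ≫ ψ = φ := by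
  obtain ⟨φ₁, hφ₁⟩ := exists_extension_of_pivot (P₀ m) (P₁ m) (vtx m 3) P₀_le_P₁
    (fun U h₁ h₀ ↦ by
      obtain ⟨_, _, _, j, hj, hj'⟩ := mem_P₁_not_P₀ h₁ h₀
      refine Or.inr (Or.inl ⟨j, hj, ?_⟩)
      rw [Finset.mem_insert, not_or]
      refine ⟨?_, hj'⟩
      rintro rfl
      simp at hj)
    (fun U h₁ h₀ ↦ by
      obtain ⟨h1, h2, ⟨x, hx, hx'⟩, _⟩ := mem_P₁_not_P₀ h₁ h₀
      have h (a : Fin (m + 5)) (ha : a ∈ U) (ha' : a.val ≠ 3) : a ∈ U.erase (vtx m 3) :=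
        Finset.mem_erase.2 ⟨fun h ↦ ha' (by rw [h]), ha⟩
      rw [mem_P₀_iff]
      rintro (H | ⟨H, _⟩ | H)
      · have := H x (h _ hx (by omega))
        omega
      · exact H _ (h _ h1 (by simp)) _ (h _ h2 (by simp)) ⟨rfl, rfl⟩
      · exact (H _ (h _ h1 (by simp))).1 rfl)
    (fun U h₁ h₀ ↦ ⟨vtx m 2, (mem_P₁_not_P₀ h₁ h₀).2.1, by simp [Fin.lt_def]⟩)
    (fun U h₁ h₀ ↦ by
      obtain ⟨_, _, ⟨x, hx, hx'⟩, _⟩ := mem_P₁_not_P₀ h₁ h₀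
      exact ⟨x, hx, by rw [Fin.lt_def]; exact hx'⟩) φ
  obtain ⟨φ₂, hφ₂⟩ := exists_extension_of_pivot (P₁ m) (P₂ m) (vtx m 2) P₁_le_P₂
    (fun U h₂ h₁ ↦ by
      obtain ⟨_, h3, _⟩ := mem_P₂_not_P₁ h₂ h₁
      refine Or.inr fun x hx ↦ ?_
      obtain rfl | hx := Finset.mem_insert.1 hx
      · simp
      · exact h3 x hx)
    (fun U h₂ h₁ ↦ by
      obtain ⟨h1, h3, h4⟩ := mem_P₂_not_P₁ h₂ h₁
      have h (a : Fin (m + 5)) (ha : a ∈ U) (ha' : a.val ≠ 2) : a ∈ U.erase (vtx m 2) :=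
        Finset.mem_erase.2 ⟨fun h ↦ ha' (by rw [h]), ha⟩
      rw [mem_P₁_iff]
      rintro (H | ⟨j, hj, hj'⟩ | H)
      · have := H _ (h (vtx m 4) (h4 _ le_rfl) (by simp))
        simp at this
      · exact hj' (h _ (h4 j hj) (by omega))
      · exact (H _ (h _ h1 (by simp))).1 rfl)
    (fun U h₂ h₁ ↦ ⟨vtx m 1, (mem_P₂_not_P₁ h₂ h₁).1, by simp [Fin.lt_def]⟩)
    (fun U h₂ h₁ ↦ ⟨vtx m 4, (mem_P₂_not_P₁ h₂ h₁).2.2 _ le_rfl, by simp [Fin.lt_def]⟩) φ₁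
  exact ⟨φ₂, by rw [← hφ₁, ← hφ₂]; rfl⟩

/-- The map on vertices which sends `0, 2` to `0`, `1, 3` to `1` and `j + 2` to `j` for
`2 ≤ j`. -/
def fold (j : Fin (m + 5)) : Fin (m + 3) :=
  ⟨if j.val < 4 then j.val % 2 else j.val - 2, by split_ifs <;> omega⟩

lemma fold_val (j : Fin (m + 5)) :
    (fold j).val = if j.val < 4 then j.val % 2 else j.val - 2 := rfl

/-- The inclusion of the face of `Δ[m + 4]` opposite to the vertices `2` and `3`. -/
def unfold : ⦋m + 2⦌ ⟶ ⦋m + 4⦌ :=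
  SimplexCategory.mkHom ⟨fun j ↦ ⟨if j.val < 2 then j.val else j.val + 2, by
    have : j.val < m + 3 := j.isLt
    split_ifs <;> omega⟩, fun a b hab ↦ by
      rw [Fin.le_def] at hab ⊢
      dsimp only
      split_ifs <;> omega⟩

lemma unfold_val (j : Fin (m + 3)) :
    ((unfold (m := m)).toOrderHom j).val = if j.val < 2 then j.val else j.val + 2 := rfl

/-- The initial edge of `Δ[m + 2]`. -/
def initialEdge (m : ℕ) : ⦋1⦌ ⟶ ⦋m + 2⦌ :=
  SimplexCategory.mkHom ⟨fun j ↦ ⟨j.val, by have : j.val < 2 := j.isLt; omega⟩, fun _ _ h ↦ h⟩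

lemma initialEdge_val (j : Fin 2) : ((initialEdge m).toOrderHom j).val = j.val := rfl

lemma initialEdge_mem_horn :
    objEquiv.symm (initialEdge m) ∈
      (Λ[m + 2, 0] : (Δ[m + 2] : SSet.{u}).Subcomplex).obj (op ⦋1⦌) := by
  rw [mem_horn_iff_notMem_range]
  refine ⟨⟨2, by omega⟩, by simp [Fin.ext_iff], ?_⟩
  rintro ⟨j, hj⟩
  have := congrArg Fin.val hj
  rw [objEquiv_symm_apply, initialEdge_val] at this
  have : j.val < 2 := j.isLt
  simp_all

end SpecialOuterHorn

open SpecialOuterHorn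

variable {C : SSet.{u}}

/-- The relation between the simplices of `Δ[m + 4]` and those of `C` induced by
a `3`-simplex and a horn. -/
def specialOuterHornRel {m : ℕ} (w : C _⦋3⦌) (h : (Λ[m + 2, 0] : SSet.{u}) ⟶ C) (d : ℕ)
    (y : (Δ[m + 4] : SSet.{u}) _⦋d⦌) (c : C _⦋d⦌) : Prop :=
  (∃ t : ⦋d⦌ ⟶ ⦋3⦌, (∀ i, (y i).val = (t.toOrderHom i).val) ∧ C.map t.op w = c) ∨
  ((∀ i j, ¬ ((y i).val = 1 ∧ (y j).val = 2)) ∧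
    ∃ t : (Λ[m + 2, 0] : SSet.{u}) _⦋d⦌, (∀ i, t.1 i = fold (y i)) ∧ h.app (op ⦋d⦌) t = c)

/-- A simplex avoiding `1` or `2` factors through the face `δ 1` or `δ 2` of `w`, and both are
degeneracies of `F` along the parity map. -/
lemma map_eq_of_not_mem_one_or_two (F : C _⦋1⦌) (w : C _⦋3⦌) (hw₁ : C.δ 1 w = C.σ 0 F)
    (hw₂ : C.δ 2 w = C.σ 1 F) {d : ℕ} (t : ⦋d⦌ ⟶ ⦋3⦌) (e : ⦋d⦌ ⟶ ⦋1⦌)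
    (ht : ∀ i j, ¬ ((t.toOrderHom i).val = 1 ∧ (t.toOrderHom j).val = 2))
    (he : ∀ i, (e.toOrderHom i).val = (t.toOrderHom i).val % 2) :
    C.map t.op w = C.map e.op F := by
  by_cases h1 : ∀ i, (t.toOrderHom i).val ≠ 1
  · have ht' : t = (t ≫ SimplexCategory.σ 1) ≫ SimplexCategory.δ 1 := by
      ext i : 3
      have key : ∀ a : Fin 4, a.val ≠ 1 →
        a = (SimplexCategory.σ (1 : Fin 3) ≫ SimplexCategory.δ (1 : Fin 4)).toOrderHom a := by
        decide
      exact key _ (h1 i)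
    have he' : e = (t ≫ SimplexCategory.σ 1) ≫ SimplexCategory.σ 0 := by
      ext i : 3
      have key : ∀ a : Fin 4, a.val ≠ 1 → ∀ b : Fin 2, b.val = a.val % 2 →
        b = (SimplexCategory.σ (1 : Fin 3) ≫ SimplexCategory.σ (0 : Fin 2)).toOrderHom a := by
        decide
      exact key _ (h1 i) _ (he i)
    rw [ht', he']
    generalize t ≫ SimplexCategory.σ 1 = s
    rw [op_comp, op_comp, Functor.map_comp_apply, Functor.map_comp_apply]
    exact congrArg _ hw₁
  · push Not at h1
    obtain ⟨i₀, hi₀⟩ := h1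
    have h2 (i) : (t.toOrderHom i).val ≠ 2 := fun h ↦ ht i₀ i ⟨hi₀, h⟩
    have ht' : t = (t ≫ SimplexCategory.σ 1) ≫ SimplexCategory.δ 2 := by
      ext i : 3
      have key : ∀ a : Fin 4, a.val ≠ 2 →
        a = (SimplexCategory.σ (1 : Fin 3) ≫ SimplexCategory.δ (2 : Fin 4)).toOrderHom a := by
        decide
      exact key _ (h2 i)
    have he' : e = (t ≫ SimplexCategory.σ 1) ≫ SimplexCategory.σ 1 := by
      ext i : 3
      have key : ∀ a : Fin 4, a.val ≠ 2 → ∀ b : Fin 2, b.val = a.val % 2 →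
        b = (SimplexCategory.σ (1 : Fin 3) ≫ SimplexCategory.σ (1 : Fin 2)).toOrderHom a := by
        decide
      exact key _ (h2 i) _ (he i)
    rw [ht', he']
    generalize t ≫ SimplexCategory.σ 1 = s
    rw [op_comp, op_comp, Functor.map_comp_apply, Functor.map_comp_apply]
    exact congrArg _ hw₂

/-- If `F` is an edge of a quasi-category which is part of the data of a `3`-simplex witnessing
that it is an equivalence, then horns `Λ[m + 2, 0]` whose initial edge is `F` can be filled. -/
theorem exists_filler_of_initialEdge [Quasicategory C] (F : C _⦋1⦌) (w : C _⦋3⦌)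
    (hw₁ : C.δ 1 w = C.σ 0 F) (hw₂ : C.δ 2 w = C.σ 1 F) {m : ℕ}
    (h : (Λ[m + 2, 0] : SSet.{u}) ⟶ C)
    (hF : h.app (op ⦋1⦌) ⟨objEquiv.symm (initialEdge m), initialEdge_mem_horn⟩ = F) :
    ∃ H : Δ[m + 2] ⟶ C, (Λ[m + 2, 0] : (Δ[m + 2] : SSet.{u}).Subcomplex).ι ≫ H = h := by
  -- On the overlap of the two recipes all vertices are `< 4`, so `fold` lands in the initial edge
  -- and both values are pulled back from `F`.
  have agree {d : ℕ} (t : ⦋d⦌ ⟶ ⦋3⦌) (t' : (Λ[m + 2, 0] : SSet.{u}) _⦋d⦌)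
      (ht : ∀ i j, ¬ ((t.toOrderHom i).val = 1 ∧ (t.toOrderHom j).val = 2))
      (htt' : ∀ i, (t'.1 i).val = (t.toOrderHom i).val % 2) :
      C.map t.op w = h.app (op ⦋d⦌) t' := by
    let e : ⦋d⦌ ⟶ ⦋1⦌ := SimplexCategory.mkHom
      ⟨fun i ↦ ⟨(t'.1 i).val, by rw [htt']; exact Nat.mod_lt _ (by decide)⟩,
        fun a b hab ↦ monotone_apply t'.1 hab⟩
    rw [map_eq_of_not_mem_one_or_two F w hw₁ hw₂ t e ht htt', ← hF]
    refine (NatTrans.naturality_apply h e.op _).symm.trans (congrArg _ (Subtype.ext ?_))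
    apply stdSimplex.ext
    intro i
    rfl
  obtain ⟨φ, hφ⟩ := exists_hom_of_rel (X := (ofLowerSet (P₀ m) : SSet.{u})) (C := C)
    (fun d y c ↦ specialOuterHornRel w h d y.1 c) (by
      rintro d ⟨y, hy⟩
      have hmem (i) : y i ∈ Finset.univ.image y := by simp
      have hmono := monotone_apply y
      have aux (h₁₂ : ∀ i j, ¬ ((y i).val = 1 ∧ (y j).val = 2))
          (hj : ∃ j : Fin (m + 3), j ≠ 0 ∧ ∀ i, fold (y i) ≠ j) :
          ∃ c, specialOuterHornRel w h d y c := by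
        refine ⟨_, Or.inr ⟨h₁₂, ⟨objMk ⟨fun i ↦ fold (y i), fun a b hab ↦ ?_⟩, ?_⟩,
          fun i ↦ rfl, rfl⟩⟩
        · have h1 : (y a).val ≤ (y b).val := hmono hab
          have h2 := h₁₂ a b
          rw [Fin.le_def, fold_val, fold_val]
          split_ifs <;> omega
        · rw [mem_horn_iff_notMem_range]
          obtain ⟨j, hj, hj'⟩ := hj
          refine ⟨j, hj, ?_⟩
          rintro ⟨i, hi⟩
          exact hj' i hi
      obtain hy | ⟨h₁₂, j, hj, hj'⟩ | hy := mem_P₀_iff.1 hy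
      · exact ⟨_, Or.inl ⟨SimplexCategory.mkHom
          ⟨fun i ↦ ⟨(y i).val, hy _ (hmem i)⟩, fun a b hab ↦ hmono hab⟩, fun i ↦ rfl, rfl⟩⟩
      · refine aux (fun i j ↦ h₁₂ _ (hmem i) _ (hmem j))
          ⟨⟨j.val - 2, by omega⟩, by simp [Fin.ext_iff]; omega, fun i hi ↦ hj' ?_⟩
        have := congrArg Fin.val hi
        rw [fold_val] at this
        obtain rfl : y i = j := Fin.ext (by dsimp only at this; split_ifs at this <;> omega)
        exact hmem i
      · refine aux (fun i j hij ↦ (hy _ (hmem i)).1 hij.1)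
          ⟨⟨1, by omega⟩, by simp, fun i hi ↦ ?_⟩
        have := congrArg Fin.val hi
        have h2 := hy _ (hmem i)
        rw [fold_val] at this
        dsimp only at this
        split_ifs at this <;> omega) (by
      rintro d ⟨y, hy⟩ c c' (⟨t, ht, rfl⟩ | ⟨h₁₂, t, ht, rfl⟩) (⟨t', ht', rfl⟩ | ⟨h₁₂', t', ht', rfl⟩)
      · obtain rfl : t = t' := by
          ext i : 3
          exact Fin.ext ((ht i).symm.trans (ht' i))
        rfl
      · refine agree _ _ (fun i j ↦ by rw [← ht, ← ht]; exact h₁₂' i j) (fun i ↦ ?_)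
        rw [ht', fold_val, ht, if_pos (by simp)]
      · refine (agree _ _ (fun i j ↦ by rw [← ht', ← ht']; exact h₁₂ i j) (fun i ↦ ?_)).symm
        rw [ht, fold_val, ht', if_pos (by simp)]
      · obtain rfl : t = t' := Subtype.ext (stdSimplex.ext _ _ fun i ↦ (ht i).trans (ht' i).symm)
        rfl) (by
      rintro d e f ⟨y, hy⟩ c (⟨t, ht, rfl⟩ | ⟨h₁₂, t, ht, rfl⟩)
      · refine Or.inl ⟨f ≫ t, fun i ↦ ht _, ?_⟩
        rw [op_comp, Functor.map_comp_apply]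
      · exact Or.inr ⟨fun i j ↦ h₁₂ _ _, (Λ[m + 2, 0] : SSet.{u}).map f.op t, fun i ↦ ht _,
          NatTrans.naturality_apply h f.op t⟩)
  obtain ⟨ψ, hψ⟩ := exists_extension φ
  -- The face omitting `2` and `3` lies in `P₂`, and `fold` restricted to it inverts `unfold`;
  -- restricting `ψ` to it therefore fills the horn.
  have hle : Subcomplex.range (SSet.stdSimplex.{u}.map (unfold (m := m))) ≤ ofLowerSet (P₂ m) := by
    rintro ⟨k⟩ _ ⟨x, rfl⟩
    induction k using SimplexCategory.rec with | _ d
    rw [mem_ofLowerSet_iff]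
    refine Or.inr fun a ha ↦ ?_
    obtain ⟨i, _, rfl⟩ := Finset.mem_image.1 ha
    rw [map_app_apply, unfold_val]
    split_ifs <;> omega
  refine ⟨Subcomplex.lift _ hle ≫ ψ, ?_⟩
  ext ⟨k⟩ x
  induction k using SimplexCategory.rec with | _ d
  let y := (SSet.stdSimplex.map (unfold (m := m))).app (op ⦋d⦌) x.1
  have hyv (i) : (y i).val = if (x.1 i).val < 2 then (x.1 i).val else (x.1 i).val + 2 := rfl
  obtain ⟨j, hj, hj'⟩ := (mem_horn_iff_notMem_range _ _).1 x.2
  have hy : y ∈ (ofLowerSet (P₀ m)).obj (op ⦋d⦌) := by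
    rw [mem_ofLowerSet_iff, mem_P₀_iff]
    have hj0 : j.val ≠ 0 := fun h ↦ hj (Fin.ext h)
    have hjx (i) : (x.1 i).val ≠ j.val := fun h ↦ hj' ⟨i, Fin.ext h⟩
    simp only [Finset.mem_image, Finset.mem_univ, true_and, forall_exists_index,
      forall_apply_eq_imp_iff, hyv]
    by_cases hj1 : j.val = 1
    · refine Or.inr (Or.inr fun i ↦ ?_)
      have := hjx i
      split_ifs <;> omega
    · refine Or.inr (Or.inl ⟨fun i i' ↦ by split_ifs <;> omega,
        ⟨j.val + 2, by omega⟩, by simp; omega, ?_⟩)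
      rintro ⟨i, hi⟩
      have h1 : (y i).val = j.val + 2 := congrArg Fin.val hi
      have h2 := hjx i
      rw [hyv] at h1
      split_ifs at h1 <;> omega
  have h1 : ψ.app (op ⦋d⦌) ⟨y, hle _ ⟨x.1, rfl⟩⟩ = φ.app (op ⦋d⦌) ⟨y, hy⟩ :=
    ConcreteCategory.congr_hom (congrArg (fun f ↦ NatTrans.app f (op ⦋d⦌)) hψ) ⟨y, hy⟩
  refine h1.trans (hφ d _ _ (Or.inr ⟨fun i i' ↦ ?_, x, fun i ↦ Fin.ext ?_, rfl⟩))
  · rw [hyv, hyv]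
    split_ifs <;> omega
  · rw [fold_val, hyv]
    split_ifs <;> omega

/-! ### Low-dimensional horn fillers and the homotopy category -/

section

variable [Quasicategory C]

lemma exists_filler_of_compatible {n : ℕ} (i : Fin (n + 3)) (h₀ : 0 < i) (h₁ : i < Fin.last _)
    (c : Fin (n + 3) → C _⦋n + 1⦌)
    (hc : ∀ (j k : Fin (n + 3)) (_ : j ≠ i) (_ : k ≠ i) (hjk : j < k),
      C.δ (k.pred (Fin.ne_zero_of_lt hjk)) (c j) = C.δ (j.castPred (Fin.ne_last_of_lt hjk)) (c k)) :
    ∃ x : C _⦋n + 2⦌, ∀ j, j ≠ i → C.δ j x = c j := by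
  have h : horn.IsCompatible (i := i) (fun j _ ↦ yonedaEquiv.symm (c j)) := by
    rw [horn.isCompatible_iff]
    intro j k hj hk hjk
    rw [stdSimplex.δ_comp_yonedaEquiv_symm, stdSimplex.δ_comp_yonedaEquiv_symm, hc j k hj hk hjk]
  obtain ⟨φ, hφ⟩ := h.exists_desc
  obtain ⟨x, hx⟩ := Quasicategory.hornFilling h₀ h₁ φ
  refine ⟨yonedaEquiv x, fun j hj ↦ ?_⟩
  rw [← stdSimplex.yonedaEquiv_δ_comp, ← horn.ι_ι i j hj, Category.assoc, ← hx, hφ j hj,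
    Equiv.apply_symm_apply]

lemma exists_filler₃₁ (c₀ c₂ c₃ : C _⦋2⦌) (h₀₂ : C.δ 1 c₀ = C.δ 0 c₂)
    (h₀₃ : C.δ 2 c₀ = C.δ 0 c₃) (h₂₃ : C.δ 2 c₂ = C.δ 2 c₃) :
    ∃ x : C _⦋3⦌, C.δ 0 x = c₀ ∧ C.δ 2 x = c₂ ∧ C.δ 3 x = c₃ := by
  obtain ⟨x, hx⟩ := exists_filler_of_compatible (C := C) (n := 1) 1 (by decide) (by decide)
    ![c₀, c₀, c₂, c₃] (by
      intro j k hj hk hjk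
      fin_cases j <;> fin_cases k <;> first | contradiction | assumption)
  exact ⟨x, hx 0 (by decide), hx 2 (by decide), hx 3 (by decide)⟩

lemma exists_filler₃₂ (c₀ c₁ c₃ : C _⦋2⦌) (h₀₁ : C.δ 0 c₀ = C.δ 0 c₁)
    (h₀₃ : C.δ 2 c₀ = C.δ 0 c₃) (h₁₃ : C.δ 2 c₁ = C.δ 1 c₃) :
    ∃ x : C _⦋3⦌, C.δ 0 x = c₀ ∧ C.δ 1 x = c₁ ∧ C.δ 3 x = c₃ := by
  obtain ⟨x, hx⟩ := exists_filler_of_compatible (C := C) (n := 1) 2 (by decide) (by decide)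
    ![c₀, c₁, c₀, c₃] (by
      intro j k hj hk hjk
      fin_cases j <;> fin_cases k <;> first | contradiction | assumption)
  exact ⟨x, hx 0 (by decide), hx 1 (by decide), hx 3 (by decide)⟩

lemma exists_filler₄₃ (c₀ c₁ c₂ c₄ : C _⦋3⦌) (h₀₁ : C.δ 0 c₀ = C.δ 0 c₁)
    (h₀₂ : C.δ 1 c₀ = C.δ 0 c₂) (h₀₄ : C.δ 3 c₀ = C.δ 0 c₄) (h₁₂ : C.δ 1 c₁ = C.δ 1 c₂)
    (h₁₄ : C.δ 3 c₁ = C.δ 1 c₄) (h₂₄ : C.δ 3 c₂ = C.δ 2 c₄) :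
    ∃ x : C _⦋4⦌, C.δ 0 x = c₀ ∧ C.δ 1 x = c₁ ∧ C.δ 2 x = c₂ ∧ C.δ 4 x = c₄ := by
  obtain ⟨x, hx⟩ := exists_filler_of_compatible (C := C) (n := 2) 3 (by decide) (by decide)
    ![c₀, c₁, c₂, c₀, c₄] (by
      intro j k hj hk hjk
      fin_cases j <;> fin_cases k <;> first | contradiction | assumption)
  exact ⟨x, hx 0 (by decide), hx 1 (by decide), hx 2 (by decide), hx 4 (by decide)⟩

/-- This gives access to the homotopy category of the 2-truncation, where existence of a triangle
becomes an equation between composites. -/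
instance : Truncated.Quasicategory₂ ((truncation 2).obj C) where
  fill21 {x₀ x₁ x₂} e₀₁ e₁₂ := by
    obtain ⟨x, hx⟩ := exists_filler_of_compatible (C := C) (n := 0) 1 (by decide) (by decide)
      ![e₁₂.edge, e₁₂.edge, e₀₁.edge] (by
        intro j k hj hk hjk
        fin_cases j <;> fin_cases k <;> first | contradiction | skip
        exact e₁₂.src_eq.trans e₀₁.tgt_eq.symm)
    have h0 : C.δ 0 x = (Edge.ofTruncated e₁₂).edge := hx 0 (by decide)
    have h2 : C.δ 2 x = (Edge.ofTruncated e₀₁).edge := hx 2 (by decide)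
    refine ⟨Edge.toTruncated (Edge.mk (C.δ 1 x) ?_ ?_),
      (Edge.CompStruct.mk (e₀₁ := Edge.ofTruncated e₀₁) (e₁₂ := Edge.ofTruncated e₁₂)
        x h2 h0 rfl).toTruncated⟩
    · rw [← Edge.src_eq (Edge.ofTruncated e₀₁), ← h2]
      exact (C.δ_comp_δ_apply (i := 1) (j := 1) le_rfl x).symm
    · rw [← Edge.tgt_eq (Edge.ofTruncated e₁₂), ← h0]
      exact (C.δ_comp_δ_apply (i := 0) (j := 0) le_rfl x)
  fill31 {x₀ x₁ x₂ x₃ e₀₁ e₁₂ e₂₃ e₀₂ e₁₃ e₀₃} f₃ f₀ f₂ := by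
    obtain ⟨x, h0, h2, h3⟩ := exists_filler₃₁ (C := C) f₀.simplex f₂.simplex f₃.simplex
      (f₀.d₁.trans f₂.d₀.symm) (f₀.d₂.trans f₃.d₀.symm) (f₂.d₂.trans f₃.d₂.symm)
    refine ⟨(Edge.CompStruct.mk (e₀₁ := Edge.ofTruncated e₀₂) (e₁₂ := Edge.ofTruncated e₂₃)
      (e₀₂ := Edge.ofTruncated e₀₃) (C.δ 1 x) ?_ ?_ ?_).toTruncated⟩
    · exact ((C.δ_comp_δ_apply (i := 1) (j := 2) (by decide) x).symm.trans
        (congrArg _ h3)).trans f₃.d₁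
    · exact ((C.δ_comp_δ_apply (i := 0) (j := 0) le_rfl x).trans (congrArg _ h0)).trans f₀.d₀
    · exact ((C.δ_comp_δ_apply (i := 1) (j := 1) le_rfl x).symm.trans (congrArg _ h2)).trans f₂.d₁
  fill32 {x₀ x₁ x₂ x₃ e₀₁ e₁₂ e₂₃ e₀₂ e₁₃ e₀₃} f₃ f₀ f₁ := by
    obtain ⟨x, h0, h1, h3⟩ := exists_filler₃₂ (C := C) f₀.simplex f₁.simplex f₃.simplex
      (f₀.d₀.trans f₁.d₀.symm) (f₀.d₂.trans f₃.d₀.symm) (f₁.d₂.trans f₃.d₁.symm)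
    refine ⟨(Edge.CompStruct.mk (e₀₁ := Edge.ofTruncated e₀₁) (e₁₂ := Edge.ofTruncated e₁₃)
      (e₀₂ := Edge.ofTruncated e₀₃) (C.δ 2 x) ?_ ?_ ?_).toTruncated⟩
    · exact ((C.δ_comp_δ_apply (i := 2) (j := 2) le_rfl x).symm.trans (congrArg _ h3)).trans f₃.d₂
    · exact ((C.δ_comp_δ_apply (i := 0) (j := 1) (by decide) x).trans (congrArg _ h0)).trans f₀.d₁
    · exact ((C.δ_comp_δ_apply (i := 1) (j := 1) le_rfl x).trans (congrArg _ h1)).trans f₁.d₁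

namespace Truncated

open HomotopyCategory₂ SimplicialObject.Truncated

variable {X : Truncated.{u} 2} [Quasicategory₂ X]

lemma Edge.nonempty_compStruct_of_inverses {x y : X _⦋0⦌₂} {f : Edge x y} {g h : Edge y x}
    (hg : CompStruct g f (Edge.id y)) (hh : CompStruct f h (Edge.id x)) :
    Nonempty (CompStruct f g (Edge.id x)) := by
  rw [CompStruct.nonempty_iff]
  have h₁ : homMk g ≫ homMk f = 𝟙 _ := hg.homotopyCategory₂_fac
  have h₂ : homMk f ≫ homMk h = 𝟙 _ := hh.homotopyCategory₂_fac
  have h₃ : homMk g = homMk h := by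
    rw [← Category.comp_id (homMk g), ← h₂, ← Category.assoc, h₁, Category.id_comp]
  rw [h₃]
  exact h₂

lemma Edge.nonempty_compStruct_of_homotopy {x y z : X _⦋0⦌₂} {f : Edge x y} {g : Edge y z}
    {h k : Edge x z} (s : CompStruct f g h) (t : CompStruct (Edge.id x) h k) :
    Nonempty (CompStruct f g k) := by
  rw [CompStruct.nonempty_iff, s.homotopyCategory₂_fac, ← t.homotopyCategory₂_fac]
  exact (Category.id_comp _).symm

end Truncated

/-- In a quasi-category, an edge with a left inverse and a right inverse is invertible. -/
lemma Edge.nonempty_invStruct {A B : C _⦋0⦌} {F : Edge A B} {G H : Edge B A}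
    (hG : CompStruct G F (Edge.id B)) (hH : CompStruct F H (Edge.id A)) :
    Nonempty F.InvStruct :=
  ⟨⟨G, .ofTruncated
    (Truncated.Edge.nonempty_compStruct_of_inverses hG.toTruncated hH.toTruncated).some, hG⟩⟩

/-- If `h` is a composite of `f` and `g`, then so is any edge which is homotopic to `h`. -/
lemma Edge.nonempty_compStruct_of_homotopy {x y z : C _⦋0⦌} {f : Edge x y} {g : Edge y z}
    {h k : Edge x z} (s : CompStruct f g h) (t : CompStruct (Edge.id x) h k) :
    Nonempty (CompStruct f g k) :=
  Truncated.Edge.nonempty_compStruct_of_homotopy s.toTruncated t.toTruncated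

/-! ### From an inverse to a coherent 3-simplex -/

/-- Coherent inverse data for an invertible edge, given by a `3`-simplex two of whose faces are
degenerate. -/
lemma Edge.InvStruct.exists_threeSimplex {A B : C _⦋0⦌} {F : Edge A B} (I : F.InvStruct) :
    ∃ w : C _⦋3⦌, C.δ 1 w = C.σ 0 F.edge ∧ C.δ 2 w = C.σ 1 F.edge := by
  set α := I.homInvId.simplex
  set β := I.invHomId.simplex
  have hα₀ : C.δ 0 α = I.inv.edge := I.homInvId.d₀
  have hα₁ : C.δ 1 α = C.σ 0 A := I.homInvId.d₁
  have hα₂ : C.δ 2 α = F.edge := I.homInvId.d₂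
  have hβ₀ : C.δ 0 β = F.edge := I.invHomId.d₀
  have hβ₁ : C.δ 1 β = C.σ 0 B := I.invHomId.d₁
  have hβ₂ : C.δ 2 β = I.inv.edge := I.invHomId.d₂
  -- `ω` has vertices `A, B, A, B` and would do if its face `γ` on `0, 2, 3` were `σ 0 F`; `γ` has
  -- the right boundary but need not be degenerate.
  obtain ⟨ω, h0, h2, h3⟩ := exists_filler₃₁ β (C.σ 1 F.edge) α
    (by
      exact hβ₁.trans ((C.δ_comp_σ_of_le_apply (i := 0) (j := 0) le_rfl F.edge).trans
        (congrArg _ F.tgt_eq)).symm)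
    (by rw [hα₀, hβ₂])
    (by rw [hα₂]; exact C.δ_comp_σ_succ_apply (i := 1) F.edge)
  set γ := C.δ 1 ω
  have hγ₀ : C.δ 0 γ = F.edge := by
    rw [← hβ₀, ← h0]; exact C.δ_comp_δ_apply (i := 0) (j := 0) le_rfl ω
  have hγ₁ : C.δ 1 γ = F.edge := by
    have := C.δ_comp_σ_self_apply (i := 1) F.edge
    refine (C.δ_comp_δ_apply (i := 1) (j := 1) le_rfl ω).symm.trans ?_
    exact (congrArg _ h2).trans this
  have hγ₂ : C.δ 2 γ = C.σ 0 A := by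
    rw [← hα₁, ← h3]; exact (C.δ_comp_δ_apply (i := 1) (j := 2) (by decide) ω).symm
  -- `θ` has vertices `B, A, A, B`; its face `δ 2` is a new triangle with boundary `G, F, id`,
  -- namely `β` corrected by the defect `γ`.
  obtain ⟨θ, k0, k1, k3⟩ := exists_filler₃₂ γ β (C.σ 1 I.inv.edge) (hγ₀.trans hβ₀.symm)
    (by
      exact hγ₂.trans ((C.δ_comp_σ_of_le_apply (i := 0) (j := 0) le_rfl I.inv.edge).trans
        (congrArg _ I.inv.tgt_eq)).symm)
    (by rw [hβ₂]; exact (C.δ_comp_σ_self_apply (i := 1) I.inv.edge).symm)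
  -- `Ω` has vertices `A, B, A, A, B`. In its face on `0, 1, 2, 4`, the triangle `0, 2, 4` comes
  -- from `σ 0 γ`, hence is `σ 0 F`, while `0, 1, 4` is still the face `σ 1 F` of `ω`.
  obtain ⟨Ω, -, l1, l2, -⟩ := exists_filler₄₃ θ (C.σ 0 γ) ω (C.σ 2 α)
    (k0.trans (C.δ_comp_σ_self_apply (i := 0) γ).symm)
    (k1.trans h0.symm)
    (by
      rw [k3, ← hα₀]
      exact (C.δ_comp_σ_of_le_apply (i := 0) (j := 1) (by decide) α).symm)
    (C.δ_comp_σ_succ_apply (i := 0) γ)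
    (by
      refine (C.δ_comp_σ_of_gt_apply (i := 2) (j := 0) (by decide) γ).trans ?_
      refine Eq.trans ?_ (C.δ_comp_σ_of_le_apply (i := 1) (j := 1) le_rfl α).symm
      rw [hγ₂, hα₁]
      exact C.σ_comp_σ_apply (i := 0) (j := 0) le_rfl A)
    (h3.trans (C.δ_comp_σ_self_apply (i := 2) α).symm)
  refine ⟨C.δ 3 Ω, ?_, ?_⟩
  · refine (C.δ_comp_δ_apply (i := 1) (j := 2) (by decide) Ω).trans ((congrArg _ l1).trans ?_)
    refine (C.δ_comp_σ_of_gt_apply (i := 1) (j := 0) (by decide) γ).trans ?_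
    rw [hγ₁]
  · exact (C.δ_comp_δ_apply (i := 2) (j := 2) le_rfl Ω).trans ((congrArg _ l2).trans h2)

end

/-! ### Paths in the right-pinched morphism space and invertibility -/

lemma coneMap_δ_zero : coneMap (SimplexCategory.δ (0 : Fin 2)) = SimplexCategory.δ (0 : Fin 3) := by
  decide

lemma coneMap_δ_one : coneMap (SimplexCategory.δ (1 : Fin 2)) = SimplexCategory.δ (1 : Fin 3) := by
  decide

/-- A path between two morphisms in the space of morphisms is a homotopy. -/
def Edge.compStructOfHomR {x y : C _⦋0⦌} {e e' : Edge x y} (p : Edge e.toHomR e'.toHomR) :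
    CompStruct (Edge.id x) e' e := by
  have h₀ : C.map (coneMap (SimplexCategory.δ (0 : Fin 2))).op p.edge.1 = e'.edge :=
    congrArg Subtype.val p.tgt_eq
  have h₁ : C.map (coneMap (SimplexCategory.δ (1 : Fin 2))).op p.edge.1 = e.edge :=
    congrArg Subtype.val p.src_eq
  have h₂ : C.δ 2 p.edge.1 = C.map (SimplexCategory.const ⦋1⦌ ⦋0⦌ 0).op x := p.edge.2.1
  have h : SimplexCategory.const ⦋1⦌ ⦋0⦌ 0 = SimplexCategory.σ 0 := by decide
  rw [coneMap_δ_zero] at h₀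
  rw [coneMap_δ_one] at h₁
  exact .mk p.edge.1 (h₂.trans (congrArg (fun f ↦ C.map (Quiver.Hom.op f) x) h)) h₀ h₁

/-- The `(∞,0)`-equivalences of a quasi-category are the invertible morphisms. -/
lemma isInftyZeroEquivalence_iff [Quasicategory C] {A B : C _⦋0⦌} (F : Edge A B) :
    IsInftyZeroEquivalence F ↔ Nonempty F.InvStruct := by
  constructor
  · rintro ⟨G, GF, FG, ⟨s⟩, ⟨t⟩, ⟨p⟩, ⟨q⟩⟩
    obtain ⟨s'⟩ := Edge.nonempty_compStruct_of_homotopy s (Edge.compStructOfHomR p)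
    -- The triangle of a path has the source of the path as its long edge. For `p` this is already
    -- `id`; for `q` it is `FG`, so the homotopy has to be reversed.
    obtain ⟨q'⟩ := Truncated.HomotopicR.symm (X := (truncation 2).obj C)
      ⟨(Edge.compStructOfHomR q).toTruncated⟩
    obtain ⟨t'⟩ := Edge.nonempty_compStruct_of_homotopy t (.ofTruncated q')
    exact ⟨⟨G, s', t'⟩⟩
  · rintro ⟨I⟩
    exact ⟨I.inv, _, _, ⟨I.homInvId⟩, ⟨I.invHomId⟩, ⟨Edge.id _⟩, ⟨Edge.id _⟩⟩

/-! ### Alternating simplices and maps out of the walking isomorphism -/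

/-- The word in `{0, 1}` corresponding to a simplex of the nerve of the walking isomorphism. -/
def coherentIso.word {d : ℕ} (s : coherentIso.{u} _⦋d⦌) (i : Fin (d + 1)) : ℕ :=
  (Codiscrete.equivFun s i).down.toNat

lemma coherentIso.word_lt {d : ℕ} (s : coherentIso.{u} _⦋d⦌) (i : Fin (d + 1)) :
    coherentIso.word s i < 2 := Bool.toNat_lt _

lemma coherentIso.word_hom (i : Fin 2) :
    coherentIso.word coherentIso.hom.{u}.edge i = i.val := by
  fin_cases i <;> rfl

/-- A monotone sequence which takes all the values `1, …, n` and is bounded by `n` is determined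
by its parity among such bounded sequences. -/
lemma eq_of_mod_two_eq {d n : ℕ} (hn : 1 ≤ n) {t t' : Fin (d + 1) → ℕ} (ht : Monotone t)
    (ht' : Monotone t') (hb : ∀ i, t i ≤ n) (hb' : ∀ i, t' i ≤ n)
    (h : ∀ i, t i % 2 = t' i % 2) (hsurj : ∀ j, 1 ≤ j → j ≤ n → ∃ i, t i = j) : t = t' := by
  have hstep (i : Fin d) : t i.succ ≤ t i.castSucc + 1 := by
    by_contra! H
    obtain ⟨k, hk⟩ := hsurj (t i.castSucc + 1) (by omega) (by have := hb i.succ; omega)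
    obtain hki | hki := le_or_gt k i.castSucc
    · have := ht hki
      omega
    · have := ht (Fin.castSucc_lt_iff_succ_le.1 hki)
      omega
  -- Forwards, `t` starts in `{0, 1}` and grows, by one, only when the parity changes, which forces
  -- `t'` to grow as well. The reverse bound runs backwards from `t = n` at the last index.
  have hle : ∀ i, t i ≤ t' i := by
    intro i
    induction i using Fin.induction with
    | zero =>
      obtain ⟨k, hk⟩ := hsurj 1 le_rfl hn
      have := ht (Fin.zero_le k)
      have := h 0
      omega
    | succ i ih =>
      have := hstep i
      have := ht' (Fin.castSucc_lt_succ (i := i)).le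
      have := h i.succ
      have := h i.castSucc
      have := ht (Fin.castSucc_lt_succ (i := i)).le
      omega
  have hge : ∀ i, t' i ≤ t i := by
    intro i
    induction i using Fin.reverseInduction with
    | last =>
      obtain ⟨k, hk⟩ := hsurj n hn le_rfl
      have := ht (Fin.le_last k)
      have := hb' (Fin.last d)
      omega
    | cast i ih =>
      have := hstep i
      have := ht' (Fin.castSucc_lt_succ (i := i)).le
      have := h i.castSucc
      omega
  exact funext fun i ↦ le_antisymm (hle i) (hge i)

/-- A simplex of `C` is alternating if its faces and degeneracies only depend on the parity
of the vertices. -/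
def IsAlternating {n : ℕ} (c : C _⦋n⦌) : Prop :=
  ∀ ⦃d : ℕ⦄ (t t' : ⦋d⦌ ⟶ ⦋n⦌),
    (∀ i, (t.toOrderHom i).val % 2 = (t'.toOrderHom i).val % 2) → C.map t.op c = C.map t'.op c

lemma isAlternating_one (F : C _⦋1⦌) : IsAlternating F := by
  intro d t t' h
  obtain rfl : t = t' := by
    ext i : 3
    have key : ∀ a b : Fin 2, a.val % 2 = b.val % 2 → a = b := by decide
    exact key _ _ (h i)
  rfl

/-- When a vertex `j ≠ 0` is omitted, values above `j` can be lowered by `2`: they stay at least `j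
- 1`, so monotonicity and parity survive while the top dimension drops by one. -/
lemma exists_mod_two_eq_of_mem_horn {n d : ℕ} (x : (Λ[n + 2, 0] : SSet.{u}) _⦋d⦌) :
    ∃ t : ⦋d⦌ ⟶ ⦋n + 1⦌, ∀ i, (t.toOrderHom i).val % 2 = (x.1 i).val % 2 := by
  obtain ⟨x, hx⟩ := x
  obtain ⟨j, hj, hjx⟩ := (mem_horn_iff_notMem_range _ _).1 hx
  have hj0 : j.val ≠ 0 := fun h ↦ hj (Fin.ext h)
  have hne (i) : (x i).val ≠ j.val := fun h ↦ hjx ⟨i, Fin.ext h⟩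
  refine ⟨SimplexCategory.mkHom
    ⟨fun i ↦ ⟨if (x i).val < j.val then (x i).val else (x i).val - 2, ?_⟩, ?_⟩, ?_⟩
  · have := (x i).isLt
    have := j.isLt
    change (if (x i).val < j.val then (x i).val else (x i).val - 2) < n + 1 + 1
    split_ifs <;> omega
  · intro a b hab
    have h1 : (x a).val ≤ (x b).val := monotone_apply x hab
    have h2 := hne a
    have h3 := hne b
    change (if (x a).val < j.val then (x a).val else (x a).val - 2) ≤
      if (x b).val < j.val then (x b).val else (x b).val - 2
    split_ifs <;> omega
  · intro i
    have := hne i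
    change (if (x i).val < j.val then (x i).val else (x i).val - 2) % 2 = (x i).val % 2
    split_ifs <;> omega

lemma IsAlternating.exists_horn {n : ℕ} {c : C _⦋n + 1⦌} (hc : IsAlternating c) :
    ∃ φ : (Λ[n + 2, 0] : SSet.{u}) ⟶ C, ∀ (d : ℕ) (x : (Λ[n + 2, 0] : SSet.{u}) _⦋d⦌)
      (t : ⦋d⦌ ⟶ ⦋n + 1⦌), (∀ i, (t.toOrderHom i).val % 2 = (x.1 i).val % 2) →
        φ.app (op ⦋d⦌) x = C.map t.op c := by
  obtain ⟨φ, hφ⟩ := exists_hom_of_rel (X := (Λ[n + 2, 0] : SSet.{u})) (C := C)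
    (fun d x z ↦ ∃ t : ⦋d⦌ ⟶ ⦋n + 1⦌,
      (∀ i, (t.toOrderHom i).val % 2 = (x.1 i).val % 2) ∧ C.map t.op c = z)
    (fun d x ↦ by
      obtain ⟨t, ht⟩ := exists_mod_two_eq_of_mem_horn x
      exact ⟨_, t, ht, rfl⟩)
    (by
      rintro d x z z' ⟨t, ht, rfl⟩ ⟨t', ht', rfl⟩
      exact hc t t' fun i ↦ (ht i).trans (ht' i).symm)
    (by
      rintro d e f x z ⟨t, ht, rfl⟩
      refine ⟨f ≫ t, fun i ↦ ht _, ?_⟩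
      rw [op_comp, Functor.map_comp_apply])
  exact ⟨φ, fun d x t ht ↦ hφ d x _ ⟨t, ht, rfl⟩⟩

open SpecialOuterHorn in
/-- Given an alternating simplex whose initial edge is invertible, an alternating
simplex of the next dimension can be constructed. -/
lemma IsAlternating.exists_succ [Quasicategory C] {n : ℕ} {c : C _⦋n + 1⦌} (hc : IsAlternating c)
    (e : ⦋1⦌ ⟶ ⦋n + 1⦌) (he : ∀ i : Fin 2, (e.toOrderHom i).val = i.val) (w : C _⦋3⦌)
    (hw₁ : C.δ 1 w = C.σ 0 (C.map e.op c)) (hw₂ : C.δ 2 w = C.σ 1 (C.map e.op c)) :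
    ∃ c' : C _⦋n + 2⦌, IsAlternating c' ∧ C.δ (Fin.last _) c' = c := by
  obtain ⟨φ, hφ⟩ := hc.exists_horn
  obtain ⟨H, hH⟩ := exists_filler_of_initialEdge _ w hw₁ hw₂ φ (by
    refine hφ _ _ e fun i ↦ ?_
    rw [he]
    rfl)
  have hH' {d : ℕ} (t : ⦋d⦌ ⟶ ⦋n + 2⦌) (t' : ⦋d⦌ ⟶ ⦋n + 1⦌)
      (ht : objEquiv.symm t ∈ (Λ[n + 2, 0] : (Δ[n + 2] : SSet.{u}).Subcomplex).obj (op ⦋d⦌))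
      (h : ∀ i, (t'.toOrderHom i).val % 2 = (t.toOrderHom i).val % 2) :
      C.map t.op (yonedaEquiv H) = C.map t'.op c := by
    rw [yonedaEquiv_naturality, ← hφ d ⟨_, ht⟩ t' h, ← hH, yonedaEquiv_comp, yonedaEquiv_map]
    rfl
  -- A simplex outside the horn hits all of `1, …, n + 2`, so its parities determine it: only
  -- simplices inside the horn have to be checked for alternation.
  have hpar {d : ℕ} (t t' : ⦋d⦌ ⟶ ⦋n + 2⦌)
      (ht : objEquiv.symm t ∉ (Λ[n + 2, 0] : (Δ[n + 2] : SSet.{u}).Subcomplex).obj (op ⦋d⦌))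
      (h : ∀ i, (t.toOrderHom i).val % 2 = (t'.toOrderHom i).val % 2) : t = t' := by
    rw [mem_horn_iff_notMem_range] at ht
    push Not at ht
    have := eq_of_mod_two_eq (d := d) (n := n + 2) (by omega)
      (t := fun i ↦ (t.toOrderHom i).val) (t' := fun i ↦ (t'.toOrderHom i).val)
      (fun a b hab ↦ t.toOrderHom.monotone hab) (fun a b hab ↦ t'.toOrderHom.monotone hab)
      (fun i ↦ Nat.le_of_lt_succ (t.toOrderHom i).isLt)
      (fun i ↦ Nat.le_of_lt_succ (t'.toOrderHom i).isLt) h (fun j hj hj' ↦ by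
        obtain ⟨i, hi⟩ := ht ⟨j, by omega⟩ (by simp [Fin.ext_iff]; omega)
        exact ⟨i, congrArg Fin.val hi⟩)
    ext i : 3
    exact Fin.ext (congrFun this i)
  refine ⟨yonedaEquiv H, fun d t t' h ↦ ?_, ?_⟩
  · by_cases ht : objEquiv.symm t ∈ (Λ[n + 2, 0] : (Δ[n + 2] : SSet.{u}).Subcomplex).obj (op ⦋d⦌)
    · by_cases ht' : objEquiv.symm t' ∈
          (Λ[n + 2, 0] : (Δ[n + 2] : SSet.{u}).Subcomplex).obj (op ⦋d⦌)
      · obtain ⟨s, hs⟩ := exists_mod_two_eq_of_mem_horn ⟨_, ht⟩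
        rw [hH' t s ht hs, hH' t' s ht' fun i ↦ (hs i).trans (h i)]
      · rw [hpar t' t ht' fun i ↦ (h i).symm]
    · rw [hpar t t' ht h]
  · refine (hH' (SimplexCategory.δ (Fin.last _)) (𝟙 _) ?_ fun i ↦ ?_).trans (by simp)
    · rw [mem_horn_iff_notMem_range]
      refine ⟨Fin.last _, by simp [Fin.ext_iff], ?_⟩
      rintro ⟨i, hi⟩
      exact Fin.succAbove_ne _ _ hi
    · have : (SimplexCategory.δ (Fin.last (n + 2))).toOrderHom i = i.castSucc :=
        Fin.succAbove_last_apply i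
      rw [this]
      rfl

section

variable [Quasicategory C] (F : C _⦋1⦌) (w : C _⦋3⦌) (hw₁ : C.δ 1 w = C.σ 0 F)
  (hw₂ : C.δ 2 w = C.σ 1 F)

/-- The alternating simplices with initial edge `F`. -/
def AlternatingExtension (n : ℕ) : Type u :=
  { c : C _⦋n + 1⦌ // IsAlternating c ∧ ∃ e : ⦋1⦌ ⟶ ⦋n + 1⦌,
    (∀ i : Fin 2, (e.toOrderHom i).val = i.val) ∧ C.map e.op c = F }

lemma δ_last_val {n : ℕ} (i : Fin (n + 1)) :
    ((SimplexCategory.δ (Fin.last (n + 1))).toOrderHom i).val = i.val :=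
  congrArg Fin.val (Fin.succAbove_last_apply i)

include hw₁ hw₂ in
lemma AlternatingExtension.exists_succ {n : ℕ} (c : AlternatingExtension F n) :
    ∃ c' : AlternatingExtension F (n + 1), C.δ (Fin.last _) c'.1 = c.1 := by
  obtain ⟨c, hc, e, he, rfl⟩ := c
  obtain ⟨c', hc', h⟩ := hc.exists_succ e he w hw₁ hw₂
  refine ⟨⟨c', hc', e ≫ SimplexCategory.δ (Fin.last _), fun i ↦ (δ_last_val _).trans (he i), ?_⟩, h⟩
  rw [op_comp, Functor.map_comp_apply]
  exact congrArg _ h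

include hw₁ hw₂ in
lemma exists_alternatingExtension :
    ∃ c : ∀ n, AlternatingExtension F n, (c 0).1 = F ∧
      ∀ n, C.δ (Fin.last _) (c (n + 1)).1 = (c n).1 := by
  choose g hg using fun n (c : AlternatingExtension F n) ↦
    AlternatingExtension.exists_succ F w hw₁ hw₂ c
  refine ⟨fun n ↦ Nat.rec ⟨F, isAlternating_one F, 𝟙 _, fun i ↦ rfl, by simp⟩ g n, rfl,
    fun n ↦ hg _ _⟩

include hw₁ hw₂ in
/-- A morphism which admits coherent inverse data extends to the nerve of the walking
isomorphism. -/
theorem exists_coherentIso_hom :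
    ∃ f : coherentIso.{u} ⟶ C, f.app (op ⦋1⦌) coherentIso.hom.edge = F := by
  obtain ⟨c, hc₀, hc⟩ := exists_alternatingExtension F w hw₁ hw₂
  -- Passing to a larger `N` changes neither the vertices nor the value, so two presentations of a
  -- word can be compared inside one alternating simplex.
  have hcN {n N : ℕ} (hN : n ≤ N) {d : ℕ} (t : ⦋d⦌ ⟶ ⦋n + 1⦌) :
      ∃ t' : ⦋d⦌ ⟶ ⦋N + 1⦌, (∀ i, (t'.toOrderHom i).val = (t.toOrderHom i).val) ∧
        C.map t'.op (c N).1 = C.map t.op (c n).1 := by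
    induction N, hN using Nat.le_induction with
    | base => exact ⟨t, fun _ ↦ rfl, rfl⟩
    | succ N hN ih =>
      obtain ⟨t', ht', h⟩ := ih
      refine ⟨t' ≫ SimplexCategory.δ (Fin.last _), fun i ↦ (δ_last_val _).trans (ht' i), ?_⟩
      rw [op_comp, Functor.map_comp_apply, ← h]
      exact congrArg _ (hc N)
  obtain ⟨f, hf⟩ := exists_hom_of_rel (X := coherentIso.{u}) (C := C)
    (fun d s z ↦ ∃ (n : ℕ) (t : ⦋d⦌ ⟶ ⦋n + 1⦌),
      (∀ i, (t.toOrderHom i).val % 2 = coherentIso.word s i) ∧ C.map t.op (c n).1 = z)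
    (fun d s ↦ by
      have hs := coherentIso.word_lt s
      -- Sending `i` to `2 * i` plus its letter is monotone for any word and bounded by `2 * d + 1`,
      -- the dimension of `c (2 * d)`.
      refine ⟨_, 2 * d, SimplexCategory.mkHom
        ⟨fun i ↦ ⟨2 * i.val + coherentIso.word s i, ?_⟩, fun a b hab ↦ ?_⟩, fun i ↦ ?_, rfl⟩
      · have := hs i
        have : i.val < d + 1 := i.isLt
        change _ < 2 * d + 1 + 1
        omega
      · obtain rfl | hab := hab.eq_or_lt
        · exact le_rfl
        · have := hs a
          have : a.val < b.val := hab
          change 2 * a.val + coherentIso.word s a ≤ 2 * b.val + coherentIso.word s b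
          omega
      · have := hs i
        change (2 * i.val + coherentIso.word s i) % 2 = _
        omega)
    (by
      rintro d s z z' ⟨n, t, ht, rfl⟩ ⟨n', t', ht', rfl⟩
      obtain ⟨s₁, h₁, h₁'⟩ := hcN (le_max_left n n') t
      obtain ⟨s₂, h₂, h₂'⟩ := hcN (le_max_right n n') t'
      rw [← h₁', ← h₂']
      exact (c _).2.1 _ _ fun i ↦ by rw [h₁, h₂, ht, ht'])
    (by
      rintro d e f s z ⟨n, t, ht, rfl⟩
      refine ⟨n, f ≫ t, fun i ↦ ht _, ?_⟩
      rw [op_comp, Functor.map_comp_apply])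
  refine ⟨f, hf 1 _ _ ⟨0, 𝟙 _, fun i ↦ ?_, by simpa using hc₀⟩⟩
  rw [coherentIso.word_hom]
  exact Nat.mod_eq_of_lt i.isLt

end

/-! ### The three extension problems -/

variable {A B : C _⦋0⦌} (F : Edge A B)

lemma comp_eq_toMap_iff {X : SSet.{u}} (x : X _⦋1⦌) (f : X ⟶ C) :
    yonedaEquiv.symm x ≫ f = F.toMap ↔ f.app (op ⦋1⦌) x = F.edge := by
  rw [yonedaEquiv_symm_comp]
  exact yonedaEquiv.symm.injective.eq_iff

/-- In a quasi-category, an edge with a left and a right inverse is invertible. -/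
lemma Edge.nonempty_invStruct_of_twoSimplices [Quasicategory C] {p q : C _⦋2⦌} {y z : C _⦋0⦌}
    (hp₀ : C.δ 0 p = F.edge) (hp₁ : C.δ 1 p = C.σ 0 y) (hq₂ : C.δ 2 q = F.edge)
    (hq₁ : C.δ 1 q = C.σ 0 z) : Nonempty F.InvStruct := by
  -- The vertices carrying the degenerate edges are not given in advance; comparing faces identifies
  -- them with the endpoints of `F`.
  obtain rfl : y = B := by
    rw [← C.δ_comp_σ_self_apply 0 y, ← F.tgt_eq, ← hp₀]
    exact (congrArg _ hp₁).symm.trans (C.δ_comp_δ_apply (i := 0) (j := 0) le_rfl p)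
  obtain rfl : z = A := by
    rw [← C.δ_comp_σ_succ_apply 0 z, ← F.src_eq, ← hq₂]
    exact (congrArg _ hq₁).symm.trans (C.δ_comp_δ_apply (i := 1) (j := 1) le_rfl q).symm
  refine Edge.nonempty_invStruct
    (G := Edge.mk (C.δ 2 p)
      (((C.δ_comp_δ_apply (i := 1) (j := 1) le_rfl p).trans (congrArg _ hp₁)).trans
        (C.δ_comp_σ_succ_apply 0 y))
      (((C.δ_comp_δ_apply (i := 0) (j := 1) (by decide) p).trans (congrArg _ hp₀)).trans
        F.src_eq))
    (H := Edge.mk (C.δ 0 q)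
      (((C.δ_comp_δ_apply (i := 0) (j := 1) (by decide) q).symm.trans (congrArg _ hq₂)).trans
        F.tgt_eq)
      (((C.δ_comp_δ_apply (i := 0) (j := 0) le_rfl q).symm.trans (congrArg _ hq₁)).trans
        (C.δ_comp_σ_self_apply 0 z)))
    (.mk p rfl hp₀ hp₁) (.mk q hq₂ rfl hq₁)

lemma Edge.InvStruct.exists_coherentIso_hom [Quasicategory C] {F : Edge A B} (I : F.InvStruct) :
    ∃ F' : coherentIso.{u} ⟶ C, walkingIsoInclusion ≫ F' = F.toMap := by
  obtain ⟨w, hw₁, hw₂⟩ := I.exists_threeSimplex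
  obtain ⟨f, hf⟩ := SSet.exists_coherentIso_hom F.edge w hw₁ hw₂
  exact ⟨f, (comp_eq_toMap_iff F _ f).2 hf⟩

lemma skTwoInclusion_ι : skTwoInclusion.{u} ≫ skTwoCoherentIso.ι = walkingIsoInclusion :=
  yonedaEquiv_symm_comp _ _

lemma nonempty_invStruct_of_skTwo [Quasicategory C] (F' : (skTwoCoherentIso.{u} : SSet.{u}) ⟶ C)
    (hF' : skTwoInclusion ≫ F' = F.toMap) : Nonempty F.InvStruct := by
  replace hF' := (comp_eq_toMap_iff F _ F').1 hF'
  let p : (skTwoCoherentIso.{u} : SSet.{u}) _⦋2⦌ :=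
    ⟨coherentIso.invHomId.simplex, mem_skeleton _ _⟩
  let q : (skTwoCoherentIso.{u} : SSet.{u}) _⦋2⦌ :=
    ⟨coherentIso.homInvId.simplex, mem_skeleton _ _⟩
  let x₀ : (skTwoCoherentIso.{u} : SSet.{u}) _⦋0⦌ := ⟨coherentIso.x₀, mem_skeleton _ _⟩
  let x₁ : (skTwoCoherentIso.{u} : SSet.{u}) _⦋0⦌ := ⟨coherentIso.x₁, mem_skeleton _ _⟩
  refine F.nonempty_invStruct_of_twoSimplices (p := F'.app _ p) (q := F'.app _ q)
    (y := F'.app _ x₁) (z := F'.app _ x₀) ?_ ?_ ?_ ?_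
  · rw [← δ_naturality_apply, ← hF']
    exact congrArg _ (Subtype.ext coherentIso.invHomId.d₀)
  · rw [← δ_naturality_apply, ← σ_naturality_apply]
    exact congrArg _ (Subtype.ext coherentIso.invHomId.d₁)
  · rw [← δ_naturality_apply, ← hF']
    exact congrArg _ (Subtype.ext coherentIso.homInvId.d₂)
  · rw [← δ_naturality_apply, ← σ_naturality_apply]
    exact congrArg _ (Subtype.ext coherentIso.homInvId.d₁)

/-- The `3`-simplex of the nerve of the walking isomorphism whose vertices alternate, starting
with the target of the isomorphism. -/
def coherentIso.threeSimplex : coherentIso.{u} _⦋3⦌ :=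
  Codiscrete.equivFun.symm ![.up true, .up false, .up true, .up false]

/-- The map to the nerve of the walking isomorphism from the quotient of `Δ[3]`
where the edges `[0, 2]` and `[1, 3]` are collapsed. -/
lemma exists_collapseTwo_hom :
    ∃ f : collapseTwo.{u} ⟶ coherentIso.{u}, collapseTwoInclusion ≫ f = walkingIsoInclusion := by
  let g : Δ[3] ⟶ coherentIso.{u} := yonedaEquiv.symm coherentIso.threeSimplex
  have h₁ : edgeThree 0 2 (by decide) ≫ g = collapse ≫ yonedaEquiv.symm coherentIso.x₁ := by
    rw [edgeThree, collapse, yonedaEquiv_symm_naturality_left, yonedaEquiv_symm_naturality_left]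
    refine congrArg _ (Codiscrete.equivFun.injective (funext fun i ↦ ?_))
    fin_cases i <;> rfl
  have h₂ : edgeThree 1 3 (by decide) ≫ g = collapse ≫ yonedaEquiv.symm coherentIso.x₀ := by
    rw [edgeThree, collapse, yonedaEquiv_symm_naturality_left, yonedaEquiv_symm_naturality_left]
    refine congrArg _ (Codiscrete.equivFun.injective (funext fun i ↦ ?_))
    fin_cases i <;> rfl
  refine ⟨pushout.desc (pushout.desc g _ h₁) (yonedaEquiv.symm coherentIso.x₀) ?_, ?_⟩
  · rw [Category.assoc, pushout.inl_desc, h₂]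
  · rw [collapseTwoInclusion, Category.assoc, Category.assoc, pushout.inl_desc, pushout.inl_desc,
      edgeThree, yonedaEquiv_symm_naturality_left, walkingIsoInclusion, Edge.toMap]
    refine congrArg _ (Codiscrete.equivFun.injective (funext fun i ↦ ?_))
    fin_cases i <;> rfl

/-- Collapsing `[0, 2]` and `[1, 3]` makes the long edges of the faces `[0, 1, 2]` and `[1, 2, 3]`
degenerate, so `[0, 1]` and `[2, 3]` become inverses of `[1, 2]` on opposite sides. -/
lemma nonempty_invStruct_of_collapseTwo [Quasicategory C] (F' : collapseTwo.{u} ⟶ C)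
    (hF' : collapseTwoInclusion ≫ F' = F.toMap) : Nonempty F.InvStruct := by
  have map_eq (i j : Fin 4) (h : i ≤ j) (g : Δ[3] ⟶ C) :
      C.map (SimplexCategory.mkOfLe i j h).op (yonedaEquiv g) =
        yonedaEquiv (edgeThree i j h ≫ g) := yonedaEquiv_naturality _ _
  have collapse_comp (y : Δ[0] ⟶ C) : yonedaEquiv (collapse ≫ y) = C.σ 0 (yonedaEquiv y) := by
    rw [collapse, ← yonedaEquiv_naturality]
    exact congrArg (fun f ↦ C.map (Quiver.Hom.op f) (yonedaEquiv y))
      (show SimplexCategory.const ⦋1⦌ ⦋0⦌ 0 = SimplexCategory.σ 0 by decide)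
  let x : Δ[3] ⟶ C := toCollapseTwo ≫ F'
  have h₁₂ : C.map (SimplexCategory.mkOfLe 1 2 (by decide) : ⦋1⦌ ⟶ ⦋3⦌).op (yonedaEquiv x) =
      F.edge := by
    rw [map_eq, ← Category.assoc]
    exact (congrArg yonedaEquiv hF').trans (Equiv.apply_symm_apply _ _)
  have h₀₂ : C.map (SimplexCategory.mkOfLe 0 2 (by decide) : ⦋1⦌ ⟶ ⦋3⦌).op (yonedaEquiv x) =
      C.σ 0 (yonedaEquiv (pushout.inr _ _ ≫ pushout.inl _ _ ≫ F')) := by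
    rw [map_eq, ← collapse_comp, ← pushout.condition_assoc]
    rfl
  have h₁₃ : C.map (SimplexCategory.mkOfLe 1 3 (by decide) : ⦋1⦌ ⟶ ⦋3⦌).op (yonedaEquiv x) =
      C.σ 0 (yonedaEquiv (pushout.inr _ _ ≫ F')) := by
    rw [map_eq, ← collapse_comp, ← pushout.condition_assoc, Category.assoc]
    rfl
  have hδ (i : Fin 4) (j : Fin 3) (f : ⦋1⦌ ⟶ ⦋3⦌)
      (hf : SimplexCategory.δ j ≫ SimplexCategory.δ i = f) :
      C.δ j (C.δ i (yonedaEquiv x)) = C.map f.op (yonedaEquiv x) := by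
    rw [← hf, op_comp, Functor.map_comp_apply]
    rfl
  exact F.nonempty_invStruct_of_twoSimplices (p := C.δ 3 (yonedaEquiv x))
    (q := C.δ 0 (yonedaEquiv x)) ((hδ _ _ _ (by decide)).trans h₁₂)
    ((hδ _ _ _ (by decide)).trans h₀₂) ((hδ _ _ _ (by decide)).trans h₁₂)
    ((hδ _ _ _ (by decide)).trans h₁₃)

end SSet

theorem mainTheorem6 (C : SSet.{u}) [SSet.Quasicategory C] {A B : C _⦋0⦌} (F : SSet.Edge A B) :
    (SSet.IsInftyZeroEquivalence F ↔
      ∃ F' : SSet.coherentIso.{u} ⟶ C, SSet.walkingIsoInclusion ≫ F' = F.toMap) ∧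
    (SSet.IsInftyZeroEquivalence F ↔
      ∃ F' : (SSet.skTwoCoherentIso.{u} : SSet.{u}) ⟶ C, SSet.skTwoInclusion ≫ F' = F.toMap) ∧
    (SSet.IsInftyZeroEquivalence F ↔
      ∃ F' : SSet.collapseTwo.{u} ⟶ C, SSet.collapseTwoInclusion ≫ F' = F.toMap) := by
  rw [SSet.isInftyZeroEquivalence_iff]
  have h₂ : Nonempty F.InvStruct →
      ∃ F' : SSet.coherentIso.{u} ⟶ C, SSet.walkingIsoInclusion ≫ F' = F.toMap :=
    fun ⟨I⟩ ↦ I.exists_coherentIso_hom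
  have h₃ : (∃ F' : SSet.coherentIso.{u} ⟶ C, SSet.walkingIsoInclusion ≫ F' = F.toMap) →
      ∃ F' : (SSet.skTwoCoherentIso.{u} : SSet.{u}) ⟶ C, SSet.skTwoInclusion ≫ F' = F.toMap := by
    rintro ⟨F', hF'⟩
    exact ⟨SSet.skTwoCoherentIso.ι ≫ F', by
      rw [← Category.assoc, SSet.skTwoInclusion_ι, hF']⟩
  have h₄ : (∃ F' : SSet.coherentIso.{u} ⟶ C, SSet.walkingIsoInclusion ≫ F' = F.toMap) →
      ∃ F' : SSet.collapseTwo.{u} ⟶ C, SSet.collapseTwoInclusion ≫ F' = F.toMap := by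
    rintro ⟨F', hF'⟩
    obtain ⟨f, hf⟩ := SSet.exists_collapseTwo_hom
    exact ⟨f ≫ F', by rw [← Category.assoc, hf, hF']⟩
  have h₁ : (∃ F' : (SSet.skTwoCoherentIso.{u} : SSet.{u}) ⟶ C,
      SSet.skTwoInclusion ≫ F' = F.toMap) → Nonempty F.InvStruct :=
    fun ⟨F', hF'⟩ ↦ SSet.nonempty_invStruct_of_skTwo F F' hF'
  have h₁' : (∃ F' : SSet.collapseTwo.{u} ⟶ C, SSet.collapseTwoInclusion ≫ F' = F.toMap) →
      Nonempty F.InvStruct :=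
    fun ⟨F', hF'⟩ ↦ SSet.nonempty_invStruct_of_collapseTwo F F' hF'
  exact ⟨⟨h₂, fun h ↦ h₁ (h₃ h)⟩, ⟨fun h ↦ h₃ (h₂ h), h₁⟩, ⟨fun h ↦ h₄ (h₂ h), h₁'⟩⟩
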